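/- **Theorem 1.** Let $g:\mathbb R\to\mathbb R$ be infinitely differentiable, with derivatives of all orders of at most polynomial growth, such that $f=e^{-g}$ is a probability density on $\mathbb R$ with finite moments of all orders. Let $\kappa\ge 0$, $\lambda_i=i^{-\kappa}$, and let $\tilde\pi_n$ be the probability law on $\mathbb R^n$ with Lebesgue density $\tilde\pi_n(x)=\prod_{i=1}^n\lambda_i^{-1}f(x_i/\lambda_i)$. Let $l,\rho>0$, and let $\sigma_n>0$ satisfy $\sigma_n^2=l^2n^{-\rho}$. Consider the Metropolis–Hastings algorithms with target $\tilde\pi_n$ and proposals $$\text{RWM: } y=x+\sigma_nZ,\qquad \text{SLA: } y=x+\tfrac{\sigma_n^2}{2}\nabla\log\tilde\pi_n(x)+\sigma_nZ,\qquad Z\sim\mathcal N(0,I_n).$$ Let $q_n(x,y)$ be the transition density of the proposal and let $$a_n(x,y)=1\wedge\frac{\tilde\pi_n(y)\,q_n(y,x)}{\tilde\pi_n(x)\,q_n(x,y)}$$ be the acceptance probability. Let $E[a_n(x,y)]$ be its mean when $x\sim\tilde\pi_n$, $Z$ is independent of $x$, and $y$ is the proposal from $x$. Put $I=1$ for RWM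 and $I=1/3$ for SLA, and put $$K^{\mathrm{RWM}}=\int_{\mathbb R} g'(u)^2f(u)\,du,\qquad K^{\mathrm{SLA}}=\frac1{48}\int_{\mathbb R}\bigl(3g''(u)^3+5g'''(u)^2\bigr)f(u)\,du,$$ $\tau^{\mathrm{RWM}}=1+2\kappa$ and $\tau^{\mathrm{SLA}}=1+6\kappa$. Let $\Phi$ be the distribution function of $\mathcal N(0,1)$. Then $K^{\mathrm{RWM}}>0$, $K^{\mathrm{SLA}}>0$, and for each of the two algorithms, as $n\to\infty$: (i) if $\rho=2\kappa+I$, then $E[a_n(x,y)]\to a(l)$, where $$a^{\mathrm{RWM}}(l)=2\Phi\Bigl(-\frac l2\sqrt{\frac{K^{\mathrm{RWM}}}{\tau^{\mathrm{RWM}}}}\Bigr),\qquad a^{\mathrm{SLA}}(l)=2\Phi\Bigl(-\frac{l^3}2\sqrt{\frac{K^{\mathrm{SLA}}}{\tau^{\mathrm{SLA}}}}\Bigr);$$ (ii) if $\rho>2\kappa+I$, then $E[a_n(x,y)]\to1$; (iii) if $2\kappa<\rho<2\kappa+I$, then $n^pE[a_n(x,y)]\to0$ for every $p\ge0$. -/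

import Mathlib

open MeasureTheory ProbabilityTheory Filter Topology
open scoped ContDiff

namespace MHScaling

/-- Standing assumptions on `g`: the function `f = exp (-g)` is a probability density on `ℝ`, `g` is
infinitely differentiable, its derivatives of all orders `k ≥ 1` have polynomial growth, and all
moments of `f` are finite. -/
structure RegularPotential (g : ℝ → ℝ) : Prop where
  smooth : ContDiff ℝ ∞ g
  growth : ∀ k : ℕ, 1 ≤ k → ∃ (C : ℝ) (m : ℕ), ∀ u : ℝ, |iteratedDeriv k g u| ≤ C * (1 + |u|) ^ m
  moments : ∀ m : ℕ, Integrable (fun u : ℝ => |u| ^ m * Real.exp (-g u)) volume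
  density : ∫ u : ℝ, Real.exp (-g u) = 1

/-- The scale `λ_i = i ^ (-κ)`, `i = 1, 2, …`; the index `i : Fin n` stands for `i + 1`. -/
noncomputable def scale (κ : ℝ) {n : ℕ} (i : Fin n) : ℝ := ((i : ℝ) + 1) ^ (-κ)

/-- The Lebesgue density `∏ i, (1 / λ_i) * exp (-g (x_i / λ_i))` of the product target. -/
noncomputable def targetDensity (g : ℝ → ℝ) (κ : ℝ) (n : ℕ) (x : Fin n → ℝ) : ℝ :=
  ∏ i : Fin n, 1 / scale κ i * Real.exp (-g (x i / scale κ i))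

/-- The product target distribution on `ℝⁿ`. -/
noncomputable def target (g : ℝ → ℝ) (κ : ℝ) (n : ℕ) : Measure (Fin n → ℝ) :=
  volume.withDensity fun x => ENNReal.ofReal (targetDensity g κ n x)

/-- The law `N(0, I_n)` of the proposal noise. -/
noncomputable def noise (n : ℕ) : Measure (Fin n → ℝ) :=
  Measure.pi fun _ : Fin n => gaussianReal 0 1

/-- The mean of the random walk proposal from `x`. -/
def meanRWM {n : ℕ} (x : Fin n → ℝ) : Fin n → ℝ := x

/-- The mean `x + (σ ^ 2 / 2) ∇ log π(x)` of the Langevin proposal from `x` for the density `π`. -/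
noncomputable def meanSLA {n : ℕ} (π : (Fin n → ℝ) → ℝ) (σ : ℝ) (x : Fin n → ℝ) : Fin n → ℝ :=
  fun i => x i + σ ^ 2 / 2 * fderiv ℝ (fun w => Real.log (π w)) x (Pi.single i 1)

/-- The proposal `y = m(x) + σ Z`, where `m` is the mean of the proposal as a function of `x`. -/
def proposal {n : ℕ} (m : (Fin n → ℝ) → Fin n → ℝ) (σ : ℝ) (x z : Fin n → ℝ) : Fin n → ℝ :=
  fun i => m x i + σ * z i

/-- The transition density `q(x, y)` of `y = m(x) + σ Z` with `Z ∼ N(0, I_n)`: the density at `y`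
of the normal law with mean `m(x)` and covariance `σ ^ 2 I_n`. -/
noncomputable def proposalDensity {n : ℕ} (m : (Fin n → ℝ) → Fin n → ℝ) (σ : ℝ)
    (x y : Fin n → ℝ) : ℝ :=
  ∏ i : Fin n, gaussianPDFReal (m x i) ⟨σ ^ 2, sq_nonneg σ⟩ (y i)

open Classical in
/-- The Metropolis–Hastings acceptance probability for the target density `π` and the transition
density `q`. -/
noncomputable def acceptance {n : ℕ} (π : (Fin n → ℝ) → ℝ) (q : (Fin n → ℝ) → (Fin n → ℝ) → ℝ)
    (x y : Fin n → ℝ) : ℝ :=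
  if 0 < π x * q x y then min 1 (π y * q y x / (π x * q x y)) else 0

/-- The mean acceptance probability `E[a(x, y)]` in stationarity, for proposals with mean `m` and
step-size `σ`: `x` has the target law, `Z ∼ N(0, I_n)` is independent of `x`, and
`y = m(x) + σ Z`. -/
noncomputable def meanAcceptance (g : ℝ → ℝ) (κ : ℝ) (n : ℕ) (m : (Fin n → ℝ) → Fin n → ℝ)
    (σ : ℝ) : ℝ :=
  ∫ p : (Fin n → ℝ) × (Fin n → ℝ),
    acceptance (targetDensity g κ n) (proposalDensity m σ) p.1 (proposal m σ p.1 p.2)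
    ∂((target g κ n).prod (noise n))

/-- Mean acceptance probability of the random walk Metropolis algorithm. -/
noncomputable def meanAcceptanceRWM (g : ℝ → ℝ) (κ : ℝ) (n : ℕ) (σ : ℝ) : ℝ :=
  meanAcceptance g κ n meanRWM σ

/-- Mean acceptance probability of the simplified Langevin algorithm. -/
noncomputable def meanAcceptanceSLA (g : ℝ → ℝ) (κ : ℝ) (n : ℕ) (σ : ℝ) : ℝ :=
  meanAcceptance g κ n (meanSLA (targetDensity g κ n) σ) σ

/-- `K^RWM = E_f[g'(X) ^ 2]`, where `f = exp (-g)`. -/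
noncomputable def constRWM (g : ℝ → ℝ) : ℝ :=
  ∫ u : ℝ, deriv g u ^ 2 * Real.exp (-g u)

/-- `K^SLA = E_f[3 g''(X) ^ 3 + 5 g'''(X) ^ 2] / 48`, where `f = exp (-g)`. -/
noncomputable def constSLA (g : ℝ → ℝ) : ℝ :=
  (∫ u : ℝ, (3 * iteratedDeriv 2 g u ^ 3 + 5 * iteratedDeriv 3 g u ^ 2) * Real.exp (-g u)) / 48

/-- The distribution function `Φ` of `N(0, 1)`. -/
noncomputable def Phi (t : ℝ) : ℝ := cdf (gaussianReal 0 1) t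

end MHScaling

/-! ### Balanced laws and test functions. -/

namespace MHScaling

/-! In the coordinates `x i / scale κ i` the log acceptance ratio is a sum of independent
one-dimensional log-ratios R with steps `ε = σ n / scale κ i` (`meanAcceptance_eq`). Reversibility
makes the law of each R `Balanced` (`balanced_ratioLaw`), which ties its mean to its variance: E
sin(tR) = -E[sin(tR) tanh(R/2)]. Every quantity needed is then the integral of a product of two
functions vanishing at 0, so only the leading term R ≈ ε^d C matters, and the mean of R never has to
be expanded to order ε^(2d). Dominated convergence gives `QuadraticScaling` with K = E[C²]
(`quadraticScaling_map`).

Hence each characteristic function is 1 - (t² + it)/2 · K ε^(2d) + o(ε^(2d)). If the sum of the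
ε^(2d) tends to S, the total log-ratio converges in law to N(-KS/2, KS), under which 1 ∧ e^x has
mean 2Φ(-√(KS)/2) (`QuadraticScaling.tendsto_integral_min_one_exp`). If the sum diverges, 1 ∧ e^x ≤
e^(x/2) and E e^(R/2) ≤ 1 - E[tanh²(R/2)]/2 give a bound exponentially small in it
(`QuadraticScaling.eventually_integral_min_one_exp_le`). The sum is asymptotic to l^(2d)
n^(1+2dκ-dρ)/(1+2dκ), and the sign of this exponent of n separates the regimes
(`QuadraticScaling.scaling_limits`).

It remains to find d and C. For the random walk the mean value theorem gives d = 1 and C = -z g'(u).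
For the Langevin proposal the log-ratio is a trapezoidal-rule error plus a correction of the same
order, so d = 3 and C = z³ g'''/12 - z g' g''/4. Gaussian moments and one integration by parts
identify E[C²] with the stated constant, and completing a square shows that it is positive. -/

/-- The law of a Metropolis–Hastings log-ratio in stationarity: tilting it by `exp` amounts to
reflecting it. -/
def Balanced (ν : Measure ℝ) : Prop :=
  ν.withDensity (fun x => ENNReal.ofReal (Real.exp x)) = ν.map (fun x => -x)

/-- `p` is continuous, vanishes at `0` with derivative `a`, and has at most linear growth. -/
structure LinearAtZero (p : ℝ → ℝ) (a : ℝ) : Prop where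
  cont : Continuous p
  zero : p 0 = 0
  deriv : HasDerivAt p a 0
  bound : ∃ A : ℝ, ∀ x, |p x| ≤ A * |x|

/-- The half-angle hyperbolic tangent `(e ^ x - 1) / (e ^ x + 1)`. -/
noncomputable def tanhHalf (x : ℝ) : ℝ := (Real.exp x - 1) / (Real.exp x + 1)

lemma abs_tanhHalf_le (x : ℝ) : |tanhHalf x| ≤ 1 * |x| := by
  have h0 := Real.exp_pos x
  rw [tanhHalf, abs_div, abs_of_pos (by linarith : 0 < Real.exp x + 1), div_le_iff₀ (by linarith)]
  have h1 := Real.add_one_le_exp x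
  have h2 := Real.add_one_le_exp (-x)
  have h3 : Real.exp x * Real.exp (-x) = 1 := by rw [← Real.exp_add]; simp
  rcases le_total 0 x with hx | hx
  · rw [abs_of_nonneg hx, abs_of_nonneg (by linarith)]
    nlinarith
  · rw [abs_of_nonpos hx, abs_of_nonpos (by linarith [Real.exp_le_one_iff.2 hx])]
    nlinarith

lemma linearAtZero_tanhHalf : LinearAtZero tanhHalf (1 / 2) where
  cont := by
    unfold tanhHalf
    exact (Real.continuous_exp.sub continuous_const).div (by fun_prop)
      fun x => by positivity
  zero := by simp [tanhHalf]
  deriv := by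
    have h1 : HasDerivAt (fun x => Real.exp x - 1) 1 0 := by
      simpa using (Real.hasDerivAt_exp 0).sub_const 1
    have h2 : HasDerivAt (fun x => Real.exp x + 1) 1 0 := by
      simpa using (Real.hasDerivAt_exp 0).add_const 1
    exact (h1.div h2 (by positivity)).congr_deriv (by norm_num)
  bound := ⟨1, abs_tanhHalf_le⟩

lemma linearAtZero_sin (t : ℝ) : LinearAtZero (fun x => Real.sin (t * x)) t where
  cont := by fun_prop
  zero := by simp
  deriv := by
    have h : HasDerivAt (fun x => t * x) t 0 := by simpa using (hasDerivAt_id (0 : ℝ)).const_mul t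
    simpa using h.sin
  bound := ⟨|t|, fun x => by rw [← abs_mul]; exact Real.abs_sin_le_abs⟩

/-! ### Consequences of balance: symmetrization, characteristic function, exponential moments. -/

namespace Balanced

variable {ν : Measure ℝ}

lemma integral_comp_neg (h : Balanced ν) (φ : ℝ → ℝ) :
    ∫ x, φ (-x) ∂ν = ∫ x, Real.exp x * φ x ∂ν := by
  have h1 := (MeasurableEquiv.neg ℝ).measurableEmbedding.integral_map (μ := ν) φ
  have h2 := integral_withDensity_eq_integral_toReal_smul (μ := ν)
    (f := fun x => ENNReal.ofReal (Real.exp x)) (by fun_prop) (by simp) φ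
  rw [show (ν.map ⇑(MeasurableEquiv.neg ℝ)) = ν.map (fun x => -x) from rfl, ← h, h2] at h1
  rw [show (∫ x, φ (-x) ∂ν) = ∫ x, φ ((MeasurableEquiv.neg ℝ) x) ∂ν from rfl, ← h1]
  refine integral_congr_ae (ae_of_all _ fun x => ?_)
  simp [ENNReal.toReal_ofReal (Real.exp_pos x).le]

lemma integrable_comp_neg_iff (h : Balanced ν) (φ : ℝ → ℝ) :
    Integrable (fun x => φ (-x)) ν ↔ Integrable (fun x => Real.exp x * φ x) ν := by
  have h1 := (MeasurableEquiv.neg ℝ).measurableEmbedding.integrable_map_iff (μ := ν) (g := φ)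
  have h2 := integrable_withDensity_iff_integrable_smul' (μ := ν)
    (f := fun x => ENNReal.ofReal (Real.exp x)) (by fun_prop) (by simp) (g := φ)
  rw [show (ν.map ⇑(MeasurableEquiv.neg ℝ)) = ν.map (fun x => -x) from rfl, ← h, h2] at h1
  rw [show (fun x => φ (-x)) = φ ∘ (MeasurableEquiv.neg ℝ) from rfl, ← h1]
  refine integrable_congr (ae_of_all _ fun x => ?_)
  simp [ENNReal.toReal_ofReal (Real.exp_pos x).le]

/-- Symmetrization: integrals against a balanced law only see the function
`(G x + e ^ x G (-x)) / (1 + e ^ x)`. -/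
lemma integral_symm (h : Balanced ν) {G : ℝ → ℝ} (hG : Integrable G ν) :
    ∫ x, G x ∂ν = ∫ x, (G x + Real.exp x * G (-x)) / (1 + Real.exp x) ∂ν := by
  have key : ∀ x : ℝ, 0 < 1 + Real.exp x := fun x => by positivity
  -- G = φ + e^x φ, and balance turns the second summand into φ(-x).
  set φ : ℝ → ℝ := fun x => G x / (1 + Real.exp x) with hφ
  have cont : Continuous fun x : ℝ => (1 + Real.exp x)⁻¹ :=
    Continuous.inv₀ (by fun_prop) fun x => (key x).ne'
  have i1 : Integrable φ ν := by
    refine hG.mono (hG.aestronglyMeasurable.mul cont.aestronglyMeasurable) (ae_of_all _ fun x => ?_)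
    simp only [hφ, norm_div, Real.norm_eq_abs, abs_of_pos (key x)]
    exact div_le_self (abs_nonneg _) (by linarith [Real.exp_pos x])
  have i2 : Integrable (fun x => Real.exp x * φ x) ν := by
    have : (fun x => Real.exp x * φ x) = fun x => G x - φ x := by
      ext x; have := (key x).ne'; simp only [hφ]; field_simp; ring
    rw [this]; exact hG.sub i1
  have i3 := (h.integrable_comp_neg_iff φ).2 i2
  calc ∫ x, G x ∂ν = ∫ x, φ x + Real.exp x * φ x ∂ν := by
        refine integral_congr_ae (ae_of_all _ fun x => ?_)
        have := (key x).ne'; simp only [hφ]; field_simp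
    _ = ∫ x, φ x + φ (-x) ∂ν := by
        rw [integral_add i1 i2, integral_add i1 i3, h.integral_comp_neg]
    _ = _ := by
        refine integral_congr_ae (ae_of_all _ fun x => ?_)
        have := (key x).ne'
        have := (key (-x)).ne'
        have e := Real.exp_pos x
        simp only [hφ, Real.exp_neg] at *
        field_simp
        ring

/-- Symmetrizing an odd function multiplies it by (1 - e^x)/(1 + e^x). This turns the first-order
term of the characteristic function into a second-order one. -/
lemma integral_sin [IsProbabilityMeasure ν] (h : Balanced ν) (t : ℝ) :
    ∫ x, Real.sin (t * x) ∂ν = -∫ x, Real.sin (t * x) * tanhHalf x ∂ν := by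
  have hi : Integrable (fun x => Real.sin (t * x)) ν :=
    Integrable.of_bound (C := 1) (by fun_prop) (ae_of_all _ fun x => Real.abs_sin_le_one _)
  rw [h.integral_symm hi, ← integral_neg]
  refine integral_congr_ae (ae_of_all _ fun x => ?_)
  have : Real.exp x + 1 ≠ 0 := by positivity
  have : 1 + Real.exp x ≠ 0 := by positivity
  simp only [tanhHalf, mul_neg, Real.sin_neg]
  field_simp
  ring

lemma charFun_eq [IsProbabilityMeasure ν] (h : Balanced ν) (t : ℝ) :
    charFun ν t = 1 - 2 * ((∫ x, Real.sin (t / 2 * x) * Real.sin (t / 2 * x) ∂ν : ℝ) : ℂ)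
      - ((∫ x, Real.sin (t * x) * tanhHalf x ∂ν : ℝ) : ℂ) * Complex.I := by
  have b1 : Integrable (fun x => Real.sin (t * x)) ν :=
    Integrable.of_bound (C := 1) (by fun_prop) (ae_of_all _ fun x => Real.abs_sin_le_one _)
  have b2 : Integrable (fun x => Real.sin (t / 2 * x) * Real.sin (t / 2 * x)) ν :=
    Integrable.of_bound (C := 1) (by fun_prop) (ae_of_all _ fun x => by
      rw [norm_mul]
      exact mul_le_one₀ (Real.abs_sin_le_one _) (norm_nonneg _) (Real.abs_sin_le_one _))
  have e : charFun ν t = ∫ x, (((1 - 2 * (Real.sin (t / 2 * x) * Real.sin (t / 2 * x)) : ℝ) : ℂ)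
      + ((Real.sin (t * x) : ℝ) : ℂ) * Complex.I) ∂ν := by
    rw [charFun_apply_real]
    refine integral_congr_ae (ae_of_all _ fun x => ?_)
    have : Real.cos (t * x) = 1 - 2 * (Real.sin (t / 2 * x) * Real.sin (t / 2 * x)) := by
      rw [show t * x = 2 * (t / 2 * x) by ring, Real.cos_two_mul]
      have := Real.sin_sq_add_cos_sq (t / 2 * x)
      linarith
    simp only
    rw [← this, ← Complex.ofReal_mul, Complex.exp_mul_I, Complex.ofReal_cos, Complex.ofReal_sin]
  rw [e, integral_add, integral_mul_const, integral_complex_ofReal, integral_complex_ofReal, h.integral_sin,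
    integral_sub (integrable_const _) (b2.const_mul 2), integral_const_mul]
  · simp
    ring
  · exact Integrable.ofReal ((integrable_const _).sub (b2.const_mul 2))
  · exact b1.ofReal.mul_const _

lemma integrable_exp [IsProbabilityMeasure ν] (h : Balanced ν) :
    Integrable (fun x => Real.exp x) ν := by
  simpa using (h.integrable_comp_neg_iff fun _ => 1).1 (integrable_const _)

lemma integrable_exp_half [IsProbabilityMeasure ν] (h : Balanced ν) :
    Integrable (fun x => Real.exp (x / 2)) ν := by
  refine ((integrable_const 1).add h.integrable_exp).mono (by fun_prop) (ae_of_all _ fun x => ?_)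
  have h1 := Real.exp_pos (x / 2)
  have h2 : Real.exp x = Real.exp (x / 2) ^ 2 := by rw [← Real.exp_nat_mul]; congr 1; ring
  simp only [Pi.add_apply, Real.norm_eq_abs, h2]
  rw [abs_of_pos h1, abs_of_pos (by positivity)]
  nlinarith

/-- The symmetrization of e^(x/2) is 1/cosh(x/2) = √(1 - tanh²(x/2)), which is at most 1 -
tanh²(x/2)/2. With y = e^(x/2) the gap is (y - 1)⁴ / (2(y² + 1)²). -/
lemma integral_exp_half_le [IsProbabilityMeasure ν] (h : Balanced ν) :
    ∫ x, Real.exp (x / 2) ∂ν ≤ 1 - (∫ x, tanhHalf x * tanhHalf x ∂ν) / 2 := by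
  have hb : ∀ x, |tanhHalf x| ≤ 1 := fun x => by
    have := Real.exp_pos x
    rw [tanhHalf, abs_div, abs_of_pos (by linarith : 0 < Real.exp x + 1),
      div_le_one (by linarith), abs_le]
    constructor <;> linarith
  have b2 : Integrable (fun x => tanhHalf x * tanhHalf x) ν :=
    Integrable.of_bound (C := 1)
      (linearAtZero_tanhHalf.cont.mul linearAtZero_tanhHalf.cont).aestronglyMeasurable
      (ae_of_all _ fun x => by
        rw [norm_mul]
        exact mul_le_one₀ (hb x) (norm_nonneg _) (hb x))
  rw [h.integral_symm h.integrable_exp_half, ← integral_div]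
  have : (1 : ℝ) - ∫ x, tanhHalf x * tanhHalf x / 2 ∂ν
      = ∫ x, (1 - tanhHalf x * tanhHalf x / 2) ∂ν := by
    rw [integral_sub (integrable_const _) (b2.div_const 2)]; simp
  rw [this]
  refine integral_mono_of_nonneg (ae_of_all _ fun x => by positivity)
    ((integrable_const _).sub (b2.div_const 2)) (ae_of_all _ fun x => ?_)
  have h1 := Real.exp_pos (x / 2)
  have h2 : Real.exp x = Real.exp (x / 2) ^ 2 := by rw [← Real.exp_nat_mul]; congr 1; ring
  simp only [tanhHalf, neg_div, Real.exp_neg, h2]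
  set y := Real.exp (x / 2)
  rw [← sub_nonneg]
  have : 1 - (y ^ 2 - 1) / (y ^ 2 + 1) * ((y ^ 2 - 1) / (y ^ 2 + 1)) / 2
      - (y + y ^ 2 * y⁻¹) / (1 + y ^ 2) = ((y - 1) ^ 2) ^ 2 / (2 * (y ^ 2 + 1) ^ 2) := by
    field_simp
    ring
  rw [this]
  positivity

/-- Mean of `1 ∧ e ^ x` under a balanced law. -/
lemma integral_min_one_exp [IsProbabilityMeasure ν] (h : Balanced ν) :
    ∫ x, min 1 (Real.exp x) ∂ν = ν.real (Set.Ici 0) + ν.real (Set.Ioi 0) := by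
  -- The part below 0 carries the weight e^x, so balance reflects it to the mass of the open
  -- positive half-line. An atom at 0 is thus counted once.
  have e1 : ∀ x : ℝ, min 1 (Real.exp x) = (Set.Ici 0).indicator (fun _ => (1 : ℝ)) x
      + Real.exp x * (Set.Iio 0).indicator (fun _ => (1 : ℝ)) x := fun x => by
    rcases le_or_gt 0 x with hx | hx
    · simp [hx, hx.not_gt]
    · simp [hx, hx.not_ge, hx.le]
  have i2 : Integrable (fun x => Real.exp x * (Set.Iio 0).indicator (fun _ => (1 : ℝ)) x) ν := by
    rw [← h.integrable_comp_neg_iff]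
    refine Integrable.of_bound (C := 1) ?_ (ae_of_all _ fun x => ?_)
    · exact ((measurable_const.indicator measurableSet_Iio).comp measurable_neg).aestronglyMeasurable
    · by_cases hx : 0 < x <;> simp [hx]
  simp_rw [e1]
  rw [integral_add ((integrable_const _).indicator measurableSet_Ici) i2, ← h.integral_comp_neg,
    integral_indicator_const _ measurableSet_Ici]
  have : (fun x : ℝ => (Set.Iio (0 : ℝ)).indicator (fun _ => (1 : ℝ)) (-x))
      = (Set.Ioi (0 : ℝ)).indicator (fun _ => 1) := by
    ext x; by_cases hx : 0 < x <;> simp [hx]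
  rw [this, integral_indicator_const _ measurableSet_Ioi]
  simp

end Balanced

/-! ### Second-order behaviour of small laws. -/

/-- The laws `ν ε` have second-order behaviour `K ε ^ (2 d)` as `ε → 0`. -/
def QuadraticScaling (ν : ℝ → Measure ℝ) (d : ℕ) (K : ℝ) : Prop :=
  ∀ (p q : ℝ → ℝ) (a b : ℝ), LinearAtZero p a → LinearAtZero q b →
    Tendsto (fun ε => (∫ x, p x * q x ∂ν ε) / ε ^ (2 * d)) (𝓝[>] 0) (𝓝 (a * b * K))

/-- Writing p(r) = `dslope p 0 r` · r, with `dslope` continuous at 0, avoids dividing by r, which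
may vanish. -/
lemma LinearAtZero.tendsto_comp_div {p : ℝ → ℝ} {a : ℝ} (hp : LinearAtZero p a)
    {α : Type*} {F : Filter α} {r s : α → ℝ} {c : ℝ} (hr0 : Tendsto r F (𝓝 0)) (hr : Tendsto (fun x => r x / s x) F (𝓝 c)) :
    Tendsto (fun x => p (r x) / s x) F (𝓝 (a * c)) := by
  have h0 : Tendsto (fun x => dslope p 0 (r x)) F (𝓝 a) := by
    have h1 : ContinuousAt (dslope p 0) 0 :=
      continuousAt_dslope_same.2 hp.deriv.differentiableAt
    have h2 : dslope p 0 0 = a := by rw [dslope_same, hp.deriv.deriv]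
    have h3 := h1.tendsto.comp hr0
    rwa [h2] at h3
  refine (h0.mul hr).congr fun x => ?_
  have := sub_smul_dslope p 0 (r x)
  simp only [hp.zero, sub_zero, smul_eq_mul] at this
  rw [← this]
  ring

/-- Laws of random variables `r ε = ε ^ d C + o(ε ^ d)` with square integrable domination scale
quadratically with constant `E[C ^ 2]`. -/
lemma quadraticScaling_map {E : Type*} [MeasurableSpace E] {μ : Measure E} {r : ℝ → E → ℝ}
    {d : ℕ} (hd : d ≠ 0) {C P : E → ℝ} (hr : ∀ ε, 0 < ε → Measurable (r ε))
    (hP : Integrable (fun x => P x ^ 2) μ)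
    (hbound : ∀ ε, 0 < ε → ε ≤ 1 → ∀ x, |r ε x| ≤ ε ^ d * P x)
    (hlim : ∀ x, Tendsto (fun ε => r ε x / ε ^ d) (𝓝[>] 0) (𝓝 (C x))) :
    QuadraticScaling (fun ε => μ.map (r ε)) d (∫ x, C x ^ 2 ∂μ) := by
  intro p q a b hp hq
  obtain ⟨A, hA⟩ := hp.bound
  obtain ⟨B, hB⟩ := hq.bound
  have hpos : ∀ᶠ ε : ℝ in 𝓝[>] 0, 0 < ε := eventually_mem_nhdsWithin
  have hle : ∀ᶠ ε : ℝ in 𝓝[>] 0, ε ≤ 1 :=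
    mem_nhdsWithin_of_mem_nhds (Iic_mem_nhds one_pos)
  have key : Tendsto (fun ε => ∫ x, p (r ε x) / ε ^ d * (q (r ε x) / ε ^ d) ∂μ) (𝓝[>] 0)
      (𝓝 (∫ x, a * C x * (b * C x) ∂μ)) := by
    refine tendsto_integral_filter_of_dominated_convergence (fun x => |A| * |B| * P x ^ 2) ?_ ?_
      (hP.const_mul _) (ae_of_all _ fun x => ?_)
    · filter_upwards [hpos] with ε h
      have := hr ε h
      have h1 := hp.cont.measurable
      have h2 := hq.cont.measurable
      fun_prop
    · filter_upwards [hpos, hle] with ε h h'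
      refine ae_of_all _ fun x => ?_
      have hb := hbound ε h h' x
      have he : 0 < ε ^ d := by positivity
      have h1 : |p (r ε x) / ε ^ d| ≤ |A| * P x := by
        rw [abs_div, abs_of_pos he, div_le_iff₀ he]
        calc _ ≤ A * |r ε x| := hA _
          _ ≤ |A| * (ε ^ d * P x) := mul_le_mul (le_abs_self A) hb (abs_nonneg _) (abs_nonneg _)
          _ = _ := by ring
      have h2 : |q (r ε x) / ε ^ d| ≤ |B| * P x := by
        rw [abs_div, abs_of_pos he, div_le_iff₀ he]
        calc _ ≤ B * |r ε x| := hB _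
          _ ≤ |B| * (ε ^ d * P x) := mul_le_mul (le_abs_self B) hb (abs_nonneg _) (abs_nonneg _)
          _ = _ := by ring
      rw [norm_mul]
      calc _ ≤ |A| * P x * (|B| * P x) :=
            mul_le_mul h1 h2 (abs_nonneg _) ((abs_nonneg _).trans h1)
        _ = _ := by ring
    · have hne : ∀ᶠ ε : ℝ in 𝓝[>] 0, ε ^ d ≠ 0 := hpos.mono fun ε h => by positivity
      -- Here `d ≠ 0` matters: convergence of `r ε x / ε ^ d` forces `r ε x → 0` only if ε^d → 0.
      have hz : Tendsto (fun ε : ℝ => ε ^ d) (𝓝[>] 0) (𝓝 0) := by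
        have : Tendsto (fun ε : ℝ => ε ^ d) (𝓝 0) (𝓝 (0 ^ d)) := (continuous_pow d).tendsto 0
        rw [zero_pow hd] at this
        exact this.mono_left nhdsWithin_le_nhds
      have hr0 : Tendsto (fun ε => r ε x) (𝓝[>] 0) (𝓝 0) := by
        have := (hlim x).mul hz
        rw [mul_zero] at this
        refine this.congr' ?_
        filter_upwards [hne] with ε h
        field_simp
      exact (hp.tendsto_comp_div hr0 (hlim x)).mul (hq.tendsto_comp_div hr0 (hlim x))
  have e : ∫ x, a * C x * (b * C x) ∂μ = a * b * ∫ x, C x ^ 2 ∂μ := by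
    rw [← integral_const_mul]
    refine integral_congr_ae (ae_of_all _ fun x => ?_)
    simp only
    ring
  rw [e] at key
  refine key.congr' ?_
  filter_upwards [hpos] with ε h
  rw [integral_map (hr ε h).aemeasurable (by
      have := hp.cont; have := hq.cont; fun_prop), ← integral_div]
  refine integral_congr_ae (ae_of_all _ fun x => ?_)
  simp only
  rw [pow_mul', sq]
  field_simp

/-! ### Sums of independent balanced variables and their Gaussian limit. -/

/-- The law of a sum of independent variables with laws `ν i`. -/
noncomputable def sumLaw {n : ℕ} (ν : Fin n → Measure ℝ) : Measure ℝ :=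
  (Measure.pi ν).map fun x => ∑ i, x i

instance {n : ℕ} (ν : Fin n → Measure ℝ) [∀ i, IsProbabilityMeasure (ν i)] :
    IsProbabilityMeasure (sumLaw ν) :=
  Measure.isProbabilityMeasure_map (by fun_prop)

lemma charFun_sumLaw {n : ℕ} (ν : Fin n → Measure ℝ) [∀ i, IsProbabilityMeasure (ν i)] (t : ℝ) :
    charFun (sumLaw ν) t = ∏ i, charFun (ν i) t := by
  simp_rw [charFun_apply_real]
  rw [sumLaw, integral_map (by fun_prop) (by fun_prop),
    ← integral_fintype_prod_eq_prod (μ := ν) (f := fun i (x : ℝ) => Complex.exp (t * x * Complex.I))]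
  refine integral_congr_ae (ae_of_all _ fun x => ?_)
  simp only [Complex.ofReal_sum, Finset.mul_sum, Finset.sum_mul, Complex.exp_sum]

lemma integral_exp_half_sumLaw {n : ℕ} (ν : Fin n → Measure ℝ) [∀ i, IsProbabilityMeasure (ν i)] :
    ∫ x, Real.exp (x / 2) ∂sumLaw ν = ∏ i, ∫ x, Real.exp (x / 2) ∂ν i := by
  rw [sumLaw, integral_map (by fun_prop) (by fun_prop),
    ← integral_fintype_prod_eq_prod (μ := ν) (f := fun i x => Real.exp (x / 2))]
  refine integral_congr_ae (ae_of_all _ fun x => ?_)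
  simp only [Finset.sum_div, Real.exp_sum]

lemma integrable_exp_half_sumLaw {n : ℕ} (ν : Fin n → Measure ℝ) [∀ i, IsProbabilityMeasure (ν i)]
    (h : ∀ i, Integrable (fun x => Real.exp (x / 2)) (ν i)) :
    Integrable (fun x => Real.exp (x / 2)) (sumLaw ν) := by
  rw [sumLaw, integrable_map_measure (by fun_prop) (by fun_prop)]
  refine (Integrable.fintype_prod h).congr (ae_of_all _ fun x => ?_)
  simp only [Finset.sum_div, Real.exp_sum, Function.comp]

/-- A Chernoff bound: 1 ∧ e^x ≤ e^(x/2), and the right side factorizes over the summands. -/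
lemma integral_min_one_exp_sumLaw_le {n : ℕ} (ν : Fin n → Measure ℝ)
    [∀ i, IsProbabilityMeasure (ν i)] (h : ∀ i, Balanced (ν i)) :
    ∫ x, min 1 (Real.exp x) ∂sumLaw ν ≤ ∏ i, ∫ x, Real.exp (x / 2) ∂ν i := by
  rw [← integral_exp_half_sumLaw]
  refine integral_mono_of_nonneg (ae_of_all _ fun x => by positivity)
    (integrable_exp_half_sumLaw ν fun i => (h i).integrable_exp_half) (ae_of_all _ fun x => ?_)
  rcases le_total 0 x with hx | hx
  · exact (min_le_left _ _).trans (Real.one_le_exp (by linarith))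
  · exact (min_le_right _ _).trans (Real.exp_le_exp.2 (by linarith))

/-- Telescoping, exchanging one factor at a time. It plays the role of Lindeberg replacement for
characteristic functions. -/
lemma norm_prod_sub_prod_le {ι : Type*} (s : Finset ι) (u v : ι → ℂ) (hu : ∀ i, ‖u i‖ ≤ 1)
    (hv : ∀ i, ‖v i‖ ≤ 1) : ‖∏ i ∈ s, u i - ∏ i ∈ s, v i‖ ≤ ∑ i ∈ s, ‖u i - v i‖ := by
  classical
  induction s using Finset.induction_on with
  | empty => simp
  | insert j s hj ih =>
    rw [Finset.prod_insert hj, Finset.prod_insert hj, Finset.sum_insert hj]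
    have e : u j * ∏ i ∈ s, u i - v j * ∏ i ∈ s, v i
        = (u j - v j) * ∏ i ∈ s, u i + v j * (∏ i ∈ s, u i - ∏ i ∈ s, v i) := by ring
    have h1 : ‖∏ i ∈ s, u i‖ ≤ 1 := by
      rw [norm_prod]; exact Finset.prod_le_one (fun _ _ => norm_nonneg _) fun i _ => hu i
    rw [e]
    refine (norm_add_le _ _).trans (add_le_add ?_ ?_)
    · rw [norm_mul]; exact mul_le_of_le_one_right (norm_nonneg _) h1
    · rw [norm_mul]; exact (mul_le_of_le_one_left (norm_nonneg _) (hv j)).trans ih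

section Array

variable {ν : ℝ → Measure ℝ} {d : ℕ} {K : ℝ} {e : (n : ℕ) → Fin n → ℝ}

/-- The exponent `-(t ^ 2 + i t) / 2` of the characteristic function of `N(-1/2, 1)`. -/
noncomputable def gaussExponent (t : ℝ) : ℂ := -((t : ℂ) ^ 2 + t * Complex.I) / 2

lemma QuadraticScaling.tendsto_charFun_sub_one (hq : QuadraticScaling ν d K)
    [∀ ε, IsProbabilityMeasure (ν ε)] (hb : ∀ ε, 0 < ε → Balanced (ν ε)) (t : ℝ) :
    Tendsto (fun ε : ℝ => (charFun (ν ε) t - 1) / (ε : ℂ) ^ (2 * d)) (𝓝[>] 0)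
      (𝓝 (gaussExponent t * K)) := by
  -- By `Balanced.charFun_eq`, this product has limit (t²/4)K and enters with factor -2. The next
  -- one has limit (t/2)K and enters with factor -i.
  have h1 := hq _ _ _ _ (linearAtZero_sin (t / 2)) (linearAtZero_sin (t / 2))
  have h2 := hq _ _ _ _ (linearAtZero_sin t) linearAtZero_tanhHalf
  have h1' := (Complex.continuous_ofReal.tendsto _).comp h1
  have h2' := (Complex.continuous_ofReal.tendsto _).comp h2
  have := (h1'.const_mul (-2)).sub (h2'.mul_const Complex.I)
  convert this.congr' ?_ using 2
  · simp only [gaussExponent]; push_cast; ring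
  · filter_upwards [self_mem_nhdsWithin] with ε hε
    have : (ε : ℂ) ^ (2 * d) ≠ 0 := pow_ne_zero _ (Complex.ofReal_ne_zero.2 (ne_of_gt hε))
    rw [(hb ε hε).charFun_eq]
    simp only [Function.comp, Complex.ofReal_div, Complex.ofReal_pow]
    field_simp
    ring

/-- Each factor is compared with exp(w ε^(2d)). The two agree up to o(ε^(2d)), and since Re w ≤ 0
both have norm at most 1, so the errors simply add up to o(1) times the sum of the ε^(2d). -/
lemma QuadraticScaling.tendsto_charFun_sumLaw (hq : QuadraticScaling ν d K) (hK : 0 ≤ K)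
    [∀ ε, IsProbabilityMeasure (ν ε)] (hb : ∀ ε, 0 < ε → Balanced (ν ε)) (hd : d ≠ 0)
    (hpos : ∀ᶠ n in atTop, ∀ i, 0 < e n i) (hsmall : ∀ δ, 0 < δ → ∀ᶠ n in atTop, ∀ i, e n i < δ)
    {S : ℝ} (hS : Tendsto (fun n => ∑ i, e n i ^ (2 * d)) atTop (𝓝 S)) (t : ℝ) :
    Tendsto (fun n => charFun (sumLaw fun i => ν (e n i)) t) atTop
      (𝓝 (Complex.exp (gaussExponent t * K * S))) := by
  set w : ℂ := gaussExponent t * K with hw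
  have h1 := hq.tendsto_charFun_sub_one hb t
  have hre : w.re ≤ 0 := by
    have : w.re = -(t ^ 2 * K / 2) := by
      rw [hw, Complex.re_mul_ofReal]
      simp [gaussExponent, ← Complex.ofReal_pow]
      ring
    rw [this]
    have : 0 ≤ t ^ 2 * K / 2 := by positivity
    linarith
  have h2 : Tendsto (fun ε : ℝ => (Complex.exp (w * (ε : ℂ) ^ (2 * d)) - 1) / (ε : ℂ) ^ (2 * d))
      (𝓝[>] 0) (𝓝 w) := by
    have hder : HasDerivAt (fun z : ℂ => Complex.exp (w * z)) w 0 := by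
      have h : HasDerivAt (fun x => w * x) w 0 := by
        simpa using (hasDerivAt_id (0 : ℂ)).const_mul w
      simpa using h.cexp
    have h3 := hasDerivAt_iff_tendsto_slope_zero.1 hder
    have h4 : Tendsto (fun ε : ℝ => (ε : ℂ) ^ (2 * d)) (𝓝[>] 0) (𝓝[≠] 0) := by
      refine tendsto_nhdsWithin_iff.2 ⟨?_, ?_⟩
      · have : Continuous fun ε : ℝ => (ε : ℂ) ^ (2 * d) := by fun_prop
        have := this.tendsto 0
        simp only [Complex.ofReal_zero, zero_pow (by omega : 2 * d ≠ 0)] at this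
        exact this.mono_left nhdsWithin_le_nhds
      · filter_upwards [self_mem_nhdsWithin] with ε hε
        have : ε ≠ 0 := (ne_of_gt hε)
        simp [this]
    refine (h3.comp h4).congr fun ε => ?_
    simp [div_eq_inv_mul]
  have h3 := h1.sub h2
  rw [sub_self] at h3
  have hS' : Tendsto (fun n => Complex.exp (w * ((∑ i, e n i ^ (2 * d) : ℝ) : ℂ))) atTop
      (𝓝 (Complex.exp (w * S))) :=
    (Complex.continuous_exp.tendsto _).comp
      (((Complex.continuous_ofReal.tendsto _).comp hS).const_mul w)
  refine (tendsto_iff_of_dist ?_).2 hS'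
  rw [Metric.tendsto_atTop']
  intro η hη
  have hSpos : 0 < |S| + 1 := by positivity
  obtain ⟨δ, hδ, hδ'⟩ : ∃ δ > 0, ∀ ε : ℝ, 0 < ε → ε < δ →
      ‖(charFun (ν ε) t - 1) / (ε : ℂ) ^ (2 * d)
        - (Complex.exp (w * (ε : ℂ) ^ (2 * d)) - 1) / (ε : ℂ) ^ (2 * d)‖ < η / (|S| + 1) := by
    have := (Metric.tendsto_nhds.1 h3) (η / (|S| + 1)) (by positivity)
    obtain ⟨δ, hδ, h⟩ := (mem_nhdsGT_iff_exists_Ioo_subset).1 this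
    exact ⟨δ, hδ, fun ε h0 hlt => by simpa using h ⟨h0, hlt⟩⟩
  have hev : ∀ᶠ n in atTop, ∑ i, e n i ^ (2 * d) < |S| + 1 :=
    hS.eventually_lt_const (by linarith [le_abs_self S])
  obtain ⟨N, hN⟩ := eventually_atTop.1 (hpos.and ((hsmall δ hδ).and hev))
  refine ⟨N, fun n hn => ?_⟩
  obtain ⟨hp, hs, hsum⟩ := hN n hn.le
  rw [dist_zero_right, Real.norm_eq_abs, abs_of_nonneg dist_nonneg, dist_eq_norm, charFun_sumLaw,
    Complex.ofReal_sum, Finset.mul_sum, Complex.exp_sum]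
  refine (norm_prod_sub_prod_le _ _ _ (fun i => norm_charFun_le_one _) fun i => ?_).trans_lt ?_
  · rw [Complex.norm_exp, Complex.re_mul_ofReal]
    refine Real.exp_le_one_iff.2 (mul_nonpos_of_nonpos_of_nonneg hre ?_)
    exact pow_nonneg (hp i).le _
  · calc ∑ i, ‖charFun (ν (e n i)) t - Complex.exp (w * ((e n i ^ (2 * d) : ℝ) : ℂ))‖
        ≤ ∑ i, η / (|S| + 1) * e n i ^ (2 * d) := by
          refine Finset.sum_le_sum fun i _ => ?_
          have h := (hδ' _ (hp i) (hs i)).le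
          have hpow : 0 < e n i ^ (2 * d) := pow_pos (hp i) _
          rw [← sub_div, norm_div, ← Complex.ofReal_pow, Complex.norm_real, Real.norm_eq_abs,
            abs_of_pos hpow, div_le_iff₀ hpow] at h
          simpa using h
      _ = η / (|S| + 1) * ∑ i, e n i ^ (2 * d) := by rw [Finset.mul_sum]
      _ < η / (|S| + 1) * (|S| + 1) := by gcongr
      _ = η := by field_simp

/-- Tilting by e^x moves the mean of a Gaussian by its variance v, so the mean -v/2 goes to v/2. The
Dirac case v = 0 is included because it is the limit law when S = 0. -/
lemma balanced_gaussianReal (v : NNReal) : Balanced (gaussianReal (-(v : ℝ) / 2) v) := by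
  rcases eq_or_ne v 0 with rfl | hv
  · simp only [NNReal.coe_zero, neg_zero, zero_div, gaussianReal_zero_var, Balanced]
    rw [Measure.map_dirac' measurable_neg]
    classical
    ext s hs
    rw [withDensity_apply _ hs, neg_zero, restrict_dirac' hs]
    by_cases h0 : (0 : ℝ) ∈ s <;> simp [h0, hs]
  · have hv' : (v : ℝ) ≠ 0 := by exact_mod_cast hv
    rw [Balanced, gaussianReal_map_neg, gaussianReal_of_var_ne_zero _ hv,
      gaussianReal_of_var_ne_zero _ hv, ← withDensity_mul _ (by fun_prop) (by fun_prop)]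
    congr 1
    ext x
    simp only [Pi.mul_apply, gaussianPDF]
    rw [← ENNReal.ofReal_mul (gaussianPDFReal_nonneg _ _ _)]
    congr 1
    simp only [gaussianPDFReal]
    rw [mul_assoc, ← Real.exp_add]
    congr 2
    field_simp
    ring

lemma integral_min_one_exp_gaussianReal (v : NNReal) :
    ∫ x, min 1 (Real.exp x) ∂gaussianReal (-(v : ℝ) / 2) v = 2 * Phi (-√v / 2) := by
  rw [(balanced_gaussianReal v).integral_min_one_exp, Phi, cdf_eq_real]
  have : NullSingletonClass (gaussianReal 0 1) := nullSingletonClass_gaussianReal one_ne_zero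
  rcases eq_or_ne v 0 with rfl | hv
  · have h1 : (gaussianReal 0 1).real (Set.Ici 0) = (gaussianReal 0 1).real (Set.Iic 0) := by
      have h := gaussianReal_map_neg (μ := 0) (v := 1)
      rw [neg_zero] at h
      conv_lhs => rw [← h, map_measureReal_apply measurable_neg measurableSet_Ici]
      congr 1
      ext x
      simp
    have h2 : (gaussianReal 0 1).real (Set.Ici 0) = 1 - (gaussianReal 0 1).real (Set.Iio 0) := by
      rw [← probReal_compl_eq_one_sub measurableSet_Iio, Set.compl_Iio]
    rw [measureReal_congr Iio_ae_eq_Iic] at h2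
    simp only [NNReal.coe_zero, neg_zero, zero_div, gaussianReal_zero_var, Real.sqrt_zero]
    have h3 : (Measure.dirac (0 : ℝ)).real (Set.Ici 0) = 1 := by simp [Measure.real]
    have h4 : (Measure.dirac (0 : ℝ)).real (Set.Ioi 0) = 0 := by simp [Measure.real]
    rw [h3, h4]
    linarith
  obtain ⟨s, rfl⟩ : ∃ s : NNReal, v = s ^ 2 := ⟨NNReal.sqrt v, by simp⟩
  have hs : (0 : ℝ) < s := by
    have : s ≠ 0 := fun h => hv (by simp [h])
    positivity
  -- The negative slope pulls half-lines above 0 back to half-lines below -s/2, as in the definition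
  -- of Φ.
  have h3 : (gaussianReal 0 1).map (fun z => -(s : ℝ) ^ 2 / 2 + -s * z)
      = gaussianReal (-((s ^ 2 : NNReal) : ℝ) / 2) (s ^ 2) := by
    have h1 := gaussianReal_map_const_mul (μ := 0) (v := 1) (-s)
    have h2 := gaussianReal_map_const_add (μ := 0) (v := s ^ 2) (-(s : ℝ) ^ 2 / 2)
    rw [zero_add] at h2
    have e : gaussianReal 0 (s ^ 2) = (gaussianReal 0 1).map (-(s : ℝ) * ·) := by
      rw [h1]
      congr 1
      · simp
      · ext; simp
    rw [NNReal.coe_pow, ← h2, e, Measure.map_map (by fun_prop) (by fun_prop)]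
    rfl
  rw [← h3, map_measureReal_apply (by fun_prop) measurableSet_Ici,
    map_measureReal_apply (by fun_prop) measurableSet_Ioi]
  have e1 : (fun z : ℝ => -(s : ℝ) ^ 2 / 2 + -s * z) ⁻¹' Set.Ici 0 = Set.Iic (-(s : ℝ) / 2) := by
    ext z
    simp only [Set.mem_preimage, Set.mem_Ici, Set.mem_Iic]
    constructor <;> intro h <;> nlinarith
  have e2 : (fun z : ℝ => -(s : ℝ) ^ 2 / 2 + -s * z) ⁻¹' Set.Ioi 0 = Set.Iio (-(s : ℝ) / 2) := by
    ext z
    simp only [Set.mem_preimage, Set.mem_Ioi, Set.mem_Iio]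
    constructor <;> intro h <;> nlinarith
  rw [e1, e2, measureReal_congr Iio_ae_eq_Iic, NNReal.coe_pow, Real.sqrt_sq hs.le]
  ring

/-- Convergence of the mean acceptance probability for a triangular array of balanced laws. -/
theorem QuadraticScaling.tendsto_integral_min_one_exp (hq : QuadraticScaling ν d K) (hK : 0 ≤ K)
    [∀ ε, IsProbabilityMeasure (ν ε)] (hb : ∀ ε, 0 < ε → Balanced (ν ε)) (hd : d ≠ 0)
    (hpos : ∀ᶠ n in atTop, ∀ i, 0 < e n i) (hsmall : ∀ δ, 0 < δ → ∀ᶠ n in atTop, ∀ i, e n i < δ)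
    {S : ℝ} (hS0 : 0 ≤ S) (hS : Tendsto (fun n => ∑ i, e n i ^ (2 * d)) atTop (𝓝 S)) :
    Tendsto (fun n => ∫ x, min 1 (Real.exp x) ∂sumLaw fun i => ν (e n i)) atTop
      (𝓝 (2 * Phi (-√(K * S) / 2))) := by
  obtain ⟨v, hv⟩ : ∃ v : NNReal, (v : ℝ) = K * S :=
    ⟨(K * S).toNNReal, Real.coe_toNNReal _ (mul_nonneg hK hS0)⟩
  have h := hq.tendsto_charFun_sumLaw hK hb hd hpos hsmall hS
  let μ : ℕ → ProbabilityMeasure ℝ := fun n => ⟨sumLaw fun i => ν (e n i), inferInstance⟩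
  let μ₀ : ProbabilityMeasure ℝ := ⟨gaussianReal (-(v : ℝ) / 2) v, inferInstance⟩
  have hw : Tendsto μ atTop (𝓝 μ₀) := by
    refine ProbabilityMeasure.tendsto_of_tendsto_charFun fun t => ?_
    have e : Complex.exp (gaussExponent t * K * S) = charFun (μ₀ : Measure ℝ) t := by
      rw [mul_assoc, ← Complex.ofReal_mul, ← hv]
      simp only [μ₀, ProbabilityMeasure.coe_mk, charFun_gaussianReal, gaussExponent]
      push_cast
      ring_nf
    rw [← e]
    exact h t
  have hbd := ProbabilityMeasure.tendsto_iff_forall_integral_tendsto.1 hw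
    (BoundedContinuousFunction.ofNormedAddCommGroup (fun x => min 1 (Real.exp x)) (by fun_prop) 1
      fun x => by
        rw [Real.norm_eq_abs, abs_of_nonneg (by positivity)]
        exact min_le_left _ _)
  have e := integral_min_one_exp_gaussianReal v
  rw [← hv, ← e]
  exact hbd

/-- Exponential smallness of the mean acceptance probability for a triangular array of balanced
laws. -/
theorem QuadraticScaling.eventually_integral_min_one_exp_le (hq : QuadraticScaling ν d K)
    (hK : 0 < K) [∀ ε, IsProbabilityMeasure (ν ε)] (hb : ∀ ε, 0 < ε → Balanced (ν ε))
    (hpos : ∀ᶠ n in atTop, ∀ i, 0 < e n i)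
    (hsmall : ∀ δ, 0 < δ → ∀ᶠ n in atTop, ∀ i, e n i < δ) :
    ∀ᶠ n in atTop, ∫ x, min 1 (Real.exp x) ∂(sumLaw fun i => ν (e n i))
      ≤ Real.exp (-(K / 16) * ∑ i, e n i ^ (2 * d)) := by
  -- The limit is K/4, so K/8 is eventually a lower bound. The factor 1/2 in `integral_exp_half_le`
  -- and 1 - x ≤ e^(-x) then give the rate K/16.
  have h1 := (hq _ _ _ _ linearAtZero_tanhHalf linearAtZero_tanhHalf).eventually_const_lt
    (show K / 8 < 1 / 2 * (1 / 2) * K by linarith)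
  obtain ⟨δ, hδ, h⟩ := (mem_nhdsGT_iff_exists_Ioo_subset).1 h1
  filter_upwards [hpos, hsmall δ hδ] with n hp hs
  refine (integral_min_one_exp_sumLaw_le _ fun i => hb _ (hp i)).trans ?_
  rw [Finset.mul_sum, Real.exp_sum]
  refine Finset.prod_le_prod (fun i _ => integral_nonneg fun x => (Real.exp_pos _).le) fun i _ => ?_
  refine (hb _ (hp i)).integral_exp_half_le.trans ?_
  have h2 : K / 8 < _ := h ⟨hp i, hs i⟩
  rw [lt_div_iff₀ (pow_pos (hp i) _)] at h2
  have h3 := Real.add_one_le_exp (-(K / 16) * e n i ^ (2 * d))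
  linarith

end Array

/-! ### One-dimensional log-ratios and detailed balance. -/

/-- The law on `ℝ` with density `exp (-g)`. -/
noncomputable def baseLaw (g : ℝ → ℝ) : Measure ℝ :=
  volume.withDensity fun u => ENNReal.ofReal (Real.exp (-g u))

/-- The one-dimensional log acceptance ratio for the density `exp (-g)` and normal proposals with
mean `m` and standard deviation `ε`. -/
noncomputable def logRatio (g m : ℝ → ℝ) (ε u v : ℝ) : ℝ :=
  g u - g v + ((v - m u) ^ 2 - (u - m v) ^ 2) / (2 * ε ^ 2)

/-- The log-ratio as a function of the current state and the proposal noise. -/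
noncomputable def noiseLogRatio (g m : ℝ → ℝ) (ε : ℝ) (w : ℝ × ℝ) : ℝ :=
  logRatio g m ε w.1 (m w.1 + ε * w.2)

/-- The law of the one-dimensional log-ratio in stationarity. -/
noncomputable def ratioLaw (g m : ℝ → ℝ) (ε : ℝ) : Measure ℝ :=
  ((baseLaw g).prod (gaussianReal 0 1)).map (noiseLogRatio g m ε)

lemma logRatio_swap (g m : ℝ → ℝ) (ε u v : ℝ) : logRatio g m ε v u = -logRatio g m ε u v := by
  simp only [logRatio]
  ring

/-- Standard deviation to variance. -/
def noiseVariance (ε : ℝ) : NNReal := ⟨ε ^ 2, sq_nonneg ε⟩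

lemma gaussianReal_eq_map_noise (a ε : ℝ) :
    gaussianReal a (noiseVariance ε) = (gaussianReal 0 1).map (fun z => a + ε * z) := by
  have h1 := gaussianReal_map_const_mul (μ := 0) (v := 1) ε
  have h2 := gaussianReal_map_const_add (μ := 0) (v := noiseVariance ε) a
  rw [zero_add] at h2
  have e : gaussianReal 0 (noiseVariance ε) = (gaussianReal 0 1).map (ε * ·) := by
    rw [h1, mul_zero, mul_one]
    rfl
  rw [← h2, e, Measure.map_map (by fun_prop) (by fun_prop)]
  rfl

/-- Detailed balance for the densities. -/
lemma exp_logRatio_mul (g m : ℝ → ℝ) {ε : ℝ} (hε : 0 < ε) (u v : ℝ) :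
    Real.exp (-g u) * gaussianPDFReal (m u) (noiseVariance ε) v * Real.exp (logRatio g m ε u v)
      = Real.exp (-g v) * gaussianPDFReal (m v) (noiseVariance ε) u := by
  have e : ((noiseVariance ε : NNReal) : ℝ) = ε ^ 2 := rfl
  simp only [gaussianPDFReal, e, logRatio]
  have : ∀ a b c d : ℝ, Real.exp a * (b * Real.exp c) * Real.exp d = b * Real.exp (a + c + d) := by
    intro a b c d; rw [Real.exp_add, Real.exp_add]; ring
  rw [this, mul_left_comm, ← Real.exp_add]
  congr 2
  field_simp
  ring

variable {g m : ℝ → ℝ}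

/-- Passing from (state, noise) to the joint Lebesgue density of (state, proposal) gives coordinates
in which the two points can be exchanged. -/
lemma lintegral_state_proposal (hg : Measurable g) (hm : Measurable m) {ε : ℝ} (hε : 0 < ε)
    {F : ℝ → ℝ → ENNReal} (hF : Measurable fun p : ℝ × ℝ => F p.1 p.2) :
    ∫⁻ w, F w.1 (m w.1 + ε * w.2) ∂((baseLaw g).prod (gaussianReal 0 1))
      = ∫⁻ u, ∫⁻ v, ENNReal.ofReal (Real.exp (-g u) * gaussianPDFReal (m u) (noiseVariance ε) v)
          * F u v := by
  have hv : noiseVariance ε ≠ 0 := by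
    intro h
    have : ε ^ 2 = 0 := congrArg NNReal.toReal h
    exact (pow_pos hε 2).ne' this
  have hm1 : Measurable fun w : ℝ × ℝ => F w.1 (m w.1 + ε * w.2) :=
    hF.comp (g := fun p : ℝ × ℝ => F p.1 p.2) (f := fun w : ℝ × ℝ => (w.1, m w.1 + ε * w.2))
      (by fun_prop)
  rw [lintegral_prod _ hm1.aemeasurable, baseLaw,
    lintegral_withDensity_eq_lintegral_mul _ (by fun_prop) hm1.lintegral_prod_right']
  refine lintegral_congr fun u => ?_
  have hF2 : Measurable (F u) := hF.comp (measurable_const.prodMk measurable_id)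
  have h1 : ∫⁻ z, F u (m u + ε * z) ∂gaussianReal 0 1
      = ∫⁻ v, gaussianPDF (m u) (noiseVariance ε) v * F u v := by
    rw [← lintegral_map (f := F u) hF2 (by fun_prop), ← gaussianReal_eq_map_noise,
      gaussianReal_of_var_ne_zero _ hv,
      lintegral_withDensity_eq_lintegral_mul _ (by fun_prop) hF2]
    rfl
  simp only [Pi.mul_apply]
  rw [h1, ← lintegral_const_mul _ (by fun_prop)]
  refine lintegral_congr fun v => ?_
  rw [ENNReal.ofReal_mul (Real.exp_pos _).le, mul_assoc]
  rfl

lemma measurable_logRatio (hg : Measurable g) (hm : Measurable m) (ε : ℝ) :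
    Measurable fun p : ℝ × ℝ => logRatio g m ε p.1 p.2 := by
  unfold logRatio
  fun_prop

lemma measurable_noiseLogRatio (hg : Measurable g) (hm : Measurable m) (ε : ℝ) :
    Measurable (noiseLogRatio g m ε) := by
  unfold noiseLogRatio logRatio
  fun_prop

lemma measurable_gaussianPDFReal_mean (hm : Measurable m) (v : NNReal) :
    Measurable fun p : ℝ × ℝ => gaussianPDFReal (m p.1) v p.2 := by
  unfold gaussianPDFReal
  fun_prop

/-- Reversibility: the stationary log-ratio of a Metropolis–Hastings move is balanced. -/
lemma balanced_ratioLaw (hg : Measurable g) (hm : Measurable m) {ε : ℝ} (hε : 0 < ε) :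
    Balanced (ratioLaw g m ε) := by
  have hr := measurable_noiseLogRatio hg hm ε
  have hl := measurable_logRatio hg hm ε
  ext s hs
  rw [withDensity_apply _ hs, Measure.map_apply measurable_neg hs, ratioLaw,
    Measure.map_apply hr (measurable_neg hs), ← lintegral_indicator hs,
    lintegral_map ((by fun_prop : Measurable _).indicator hs) hr,
    ← lintegral_indicator_one (hr (measurable_neg hs))]
  have hA : Measurable fun p : ℝ × ℝ =>
      s.indicator (fun x => ENNReal.ofReal (Real.exp x)) (logRatio g m ε p.1 p.2) :=
    ((by fun_prop : Measurable fun x => ENNReal.ofReal (Real.exp x)).indicator hs).comp hl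
  have hB : Measurable fun p : ℝ × ℝ =>
      s.indicator (1 : ℝ → ENNReal) (-logRatio g m ε p.1 p.2) :=
    (measurable_one.indicator hs).comp hl.neg
  have e1 := lintegral_state_proposal hg hm hε
    (F := fun u v => s.indicator (fun x => ENNReal.ofReal (Real.exp x)) (logRatio g m ε u v)) hA
  have e2 := lintegral_state_proposal hg hm hε
    (F := fun u v => s.indicator (1 : ℝ → ENNReal) (-logRatio g m ε u v)) hB
  refine e1.trans (Eq.trans ?_ e2.symm)
  -- Exchanging state and proposal changes the sign of the log-ratio, while detailed balance absorbs
  -- the weight e^R into the exchanged density.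
  rw [lintegral_lintegral_swap]
  · refine lintegral_congr fun v => lintegral_congr fun u => ?_
    rw [← logRatio_swap g m ε v u]
    by_cases h : logRatio g m ε u v ∈ s
    · simp only [Set.indicator_of_mem h, Pi.one_apply, mul_one]
      rw [← ENNReal.ofReal_mul (mul_nonneg (Real.exp_pos _).le (gaussianPDFReal_nonneg _ _ _)),
        exp_logRatio_mul g m hε]
    · simp [Set.indicator_of_notMem h]
  · have := measurable_gaussianPDFReal_mean hm (noiseVariance ε)
    exact (Measurable.mul (by fun_prop) hA).aemeasurable

/-! ### Reduction of the product target to one dimension. -/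

lemma scale_pos (κ : ℝ) {n : ℕ} (i : Fin n) : 0 < scale κ i := by
  unfold scale
  positivity

lemma RegularPotential.integrable_exp_neg {g : ℝ → ℝ} (hg : RegularPotential g) :
    Integrable fun u => Real.exp (-g u) := by
  simpa using hg.moments 0

lemma RegularPotential.isProbabilityMeasure_baseLaw {g : ℝ → ℝ} (hg : RegularPotential g) :
    IsProbabilityMeasure (baseLaw g) := by
  refine ⟨?_⟩
  rw [baseLaw, withDensity_apply _ MeasurableSet.univ, setLIntegral_univ, ← ofReal_integral_eq_lintegral_ofReal hg.integrable_exp_neg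
    (ae_of_all _ fun u => (Real.exp_pos _).le), hg.density, ENNReal.ofReal_one]

lemma map_mul_baseLaw {g : ℝ → ℝ} {c : ℝ} (hc : 0 < c) :
    (baseLaw g).map (fun u => c * u)
      = volume.withDensity fun x => ENNReal.ofReal (1 / c * Real.exp (-g (x / c))) := by
  ext s hs
  have hm : MeasurableEmbedding fun u : ℝ => c * u :=
    (MeasurableEquiv.mulLeft₀ c hc.ne').measurableEmbedding
  rw [Measure.map_apply (by fun_prop) hs, baseLaw, withDensity_apply _ (hm.measurable hs),
    withDensity_apply _ hs]
  have h := hm.restrict_map volume s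
  have h1 : ∫⁻ u in (fun u => c * u) ⁻¹' s, ENNReal.ofReal (Real.exp (-g u))
      = ∫⁻ x in s, ENNReal.ofReal (Real.exp (-g (x / c))) ∂(volume.map fun u : ℝ => c * u) := by
    rw [h, hm.lintegral_map]
    refine lintegral_congr fun u => ?_
    rw [mul_div_cancel_left₀ _ hc.ne']
  rw [h1, Real.map_volume_mul_left hc.ne', Measure.restrict_smul, lintegral_smul_measure,
    smul_eq_mul, ← lintegral_const_mul' _ _ ENNReal.ofReal_ne_top]
  refine lintegral_congr fun x => ?_
  rw [ENNReal.ofReal_mul (by positivity), abs_of_pos (by positivity), one_div]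

lemma pi_withDensity_ofReal {ι : Type*} [Fintype ι] {h : ι → ℝ → ℝ} (hi : ∀ i, Integrable (h i))
    (h0 : ∀ i x, 0 ≤ h i x) :
    Measure.pi (fun i => (volume : Measure ℝ).withDensity fun x => ENNReal.ofReal (h i x))
      = volume.withDensity fun x => ENNReal.ofReal (∏ i, h i (x i)) := by
  have (i : ι) : IsFiniteMeasure ((volume : Measure ℝ).withDensity
      fun x => ENNReal.ofReal (h i x)) := isFiniteMeasure_withDensity_ofReal (hi i).2
  refine (Measure.pi_eq fun s hs => ?_)
  rw [withDensity_apply _ (MeasurableSet.univ_pi hs), volume_pi, Measure.restrict_pi_pi,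
    ← ofReal_integral_eq_lintegral_ofReal (Integrable.fintype_prod fun i => (hi i).restrict)
      (ae_of_all _ fun x => Finset.prod_nonneg fun i _ => h0 i _),
    integral_fintype_prod_eq_prod,
    ENNReal.ofReal_prod_of_nonneg fun i _ => integral_nonneg fun x => h0 i x]
  refine Finset.prod_congr rfl fun i _ => ?_
  rw [withDensity_apply _ (hs i), ofReal_integral_eq_lintegral_ofReal (hi i).restrict
    (ae_of_all _ (h0 i))]

lemma RegularPotential.target_eq {g : ℝ → ℝ} (hg : RegularPotential g) (κ : ℝ) (n : ℕ) :
    target g κ n = Measure.pi fun i : Fin n => (baseLaw g).map (fun u => scale κ i * u) := by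
  simp_rw [map_mul_baseLaw (scale_pos κ _)]
  rw [pi_withDensity_ofReal
    (h := fun (i : Fin n) x => 1 / scale κ i * Real.exp (-g (x / scale κ i)))]
  · rfl
  · exact fun i => (hg.integrable_exp_neg.comp_div (scale_pos κ i).ne').const_mul _
  · exact fun i x => mul_nonneg (one_div_nonneg.2 (scale_pos κ i).le) (Real.exp_pos _).le

lemma gaussianPDFReal_scale {c σ : ℝ} (hc : 0 < c) (hσ : 0 < σ) (a b : ℝ) :
    gaussianPDFReal (c * a) (noiseVariance σ) (c * b)
      = c⁻¹ * gaussianPDFReal a (noiseVariance (σ / c)) b := by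
  have e (ε : ℝ) : ((noiseVariance ε : NNReal) : ℝ) = ε ^ 2 := rfl
  simp only [gaussianPDFReal, e]
  rw [← mul_assoc]
  congr 1
  · rw [div_pow, ← mul_div_assoc, Real.sqrt_div' _ (by positivity), Real.sqrt_sq hc.le]
    field_simp
  · congr 1
    field_simp

section Reduction

variable {g : ℝ → ℝ} {κ : ℝ} {n : ℕ} {m : (Fin n → ℝ) → Fin n → ℝ} {m₁ : Fin n → ℝ → ℝ} {σ : ℝ}

/-- The acceptance probability factorizes over coordinates, in the rescaled variables. -/
lemma acceptance_eq (hσ : 0 < σ)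
    (hm : ∀ u : Fin n → ℝ, ∀ i, m (fun j => scale κ j * u j) i = scale κ i * m₁ i (u i))
    (u z : Fin n → ℝ) :
    acceptance (targetDensity g κ n) (proposalDensity m σ) (fun i => scale κ i * u i)
        (proposal m σ (fun i => scale κ i * u i) z)
      = min 1 (Real.exp (∑ i, noiseLogRatio g (m₁ i) (σ / scale κ i) (u i, z i))) := by
  set v : Fin n → ℝ := fun i => m₁ i (u i) + σ / scale κ i * z i with hv
  have hy : proposal m σ (fun i => scale κ i * u i) z = fun i => scale κ i * v i := by
    ext i
    have := (scale_pos κ i).ne'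
    simp only [proposal, hm, hv]
    field_simp
  have hvar : (⟨σ ^ 2, sq_nonneg σ⟩ : NNReal) = noiseVariance σ := rfl
  have hv0 : noiseVariance σ ≠ 0 := by
    intro h
    have : σ ^ 2 = 0 := congrArg NNReal.toReal h
    exact (pow_pos hσ 2).ne' this
  have hπ : ∀ x, 0 < targetDensity g κ n x := fun x =>
    Finset.prod_pos fun i _ => mul_pos (one_div_pos.2 (scale_pos κ i)) (Real.exp_pos _)
  have hqpos : ∀ x y, 0 < proposalDensity m σ x y := fun x y =>
    Finset.prod_pos fun i _ => gaussianPDFReal_pos _ _ _ hv0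
  have hpos := mul_pos (hπ fun i => scale κ i * u i)
    (hqpos (fun i => scale κ i * u i) fun i => scale κ i * v i)
  -- Both densities are positive everywhere, so the default value 0 of `acceptance` never occurs.
  rw [hy, acceptance, if_pos hpos]
  congr 1
  rw [div_eq_iff hpos.ne']
  simp only [targetDensity, proposalDensity, hm, hvar, Real.exp_sum]
  simp only [← Finset.prod_mul_distrib]
  refine Finset.prod_congr rfl fun i _ => ?_
  have hs := scale_pos κ i
  have h := exp_logRatio_mul g (m₁ i) (div_pos hσ hs) (u i) (v i)
  rw [gaussianPDFReal_scale hs hσ, gaussianPDFReal_scale hs hσ, mul_div_cancel_left₀ _ hs.ne',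
    mul_div_cancel_left₀ _ hs.ne']
  simp only [noiseLogRatio]
  change _ = Real.exp (logRatio g (m₁ i) (σ / scale κ i) (u i) (v i)) * _
  linear_combination (-(1 / scale κ i * (scale κ i)⁻¹)) * h

/-- The mean acceptance probability is the mean of `1 ∧ e ^ R` for a sum `R` of independent
one-dimensional log-ratios. -/
theorem meanAcceptance_eq (hg : RegularPotential g) (hσ : 0 < σ) (hm₁ : ∀ i, Measurable (m₁ i))
    (hm : ∀ u : Fin n → ℝ, ∀ i, m (fun j => scale κ j * u j) i = scale κ i * m₁ i (u i)) :
    meanAcceptance g κ n m σ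
      = ∫ x, min 1 (Real.exp x) ∂sumLaw fun i => ratioLaw g (m₁ i) (σ / scale κ i) := by
  have := hg.isProbabilityMeasure_baseLaw
  have hgm : Measurable g := hg.smooth.continuous.measurable
  have hr (i : Fin n) := measurable_noiseLogRatio hgm (hm₁ i) (σ / scale κ i)
  have (i : Fin n) : IsProbabilityMeasure ((baseLaw g).map (fun u => scale κ i * u)) :=
    Measure.isProbabilityMeasure_map (by fun_prop)
  let e₁ := MeasurableEquiv.arrowProdEquivProdArrow ℝ ℝ (Fin n)
  let e₂ : (Fin n → ℝ) ≃ᵐ (Fin n → ℝ) :=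
    MeasurableEquiv.piCongrRight fun i => MeasurableEquiv.mulLeft₀ (scale κ i) (scale_pos κ i).ne'
  have : IsProbabilityMeasure (noise n) := by unfold noise; infer_instance
  have p₁ := measurePreserving_arrowProdEquivProdArrow ℝ ℝ (Fin n) (fun _ => baseLaw g)
    (fun _ => gaussianReal 0 1)
  have p₂ : MeasurePreserving e₂ (Measure.pi fun _ => baseLaw g) (target g κ n) := by
    refine ⟨e₂.measurable, ?_⟩
    rw [hg.target_eq]
    exact Measure.pi_map_pi (μ := fun _ => baseLaw g) (f := fun i u => scale κ i * u)
      fun i => by fun_prop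
  have p₃ : MeasurePreserving (Prod.map e₂ id) _ ((target g κ n).prod (noise n)) :=
    p₂.prod (MeasurePreserving.id (noise n))
  have p := p₃.comp p₁
  -- Since the change of variables is a measurable embedding, no measurability of `acceptance` has
  -- to be proved.
  have hemb : MeasurableEmbedding (Prod.map e₂ id ∘ e₁) :=
    ((e₂.prodCongr (MeasurableEquiv.refl _)).measurableEmbedding).comp e₁.measurableEmbedding
  rw [meanAcceptance, ← p.integral_comp hemb]
  have hpi := Measure.pi_map_pi (μ := fun _ : Fin n => (baseLaw g).prod (gaussianReal 0 1))
    (f := fun i => noiseLogRatio g (m₁ i) (σ / scale κ i)) fun i => (hr i).aemeasurable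
  have hr' : Measurable fun (w : Fin n → ℝ × ℝ) i =>
      noiseLogRatio g (m₁ i) (σ / scale κ i) (w i) :=
    measurable_pi_lambda _ fun i => (hr i).comp (measurable_pi_apply i)
  simp only [sumLaw, ratioLaw]
  rw [← hpi, Measure.map_map (by fun_prop) (by fun_prop),
    integral_map (Measurable.aemeasurable (by fun_prop)) (by fun_prop)]
  refine integral_congr_ae (ae_of_all _ fun w => ?_)
  exact acceptance_eq hσ hm (fun i => (w i).1) fun i => (w i).2

lemma meanAcceptanceRWM_eq (hg : RegularPotential g) (hσ : 0 < σ) :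
    meanAcceptanceRWM g κ n σ = ∫ x, min 1 (Real.exp x)
      ∂sumLaw fun i : Fin n => ratioLaw g (fun u => u) (σ / scale κ i) :=
  meanAcceptance_eq hg hσ (fun _ => measurable_id) fun _ _ => rfl

lemma meanSLA_targetDensity (hg : RegularPotential g) (x : Fin n → ℝ) (i : Fin n) :
    meanSLA (targetDensity g κ n) σ x i
      = x i - σ ^ 2 / 2 * (deriv g (x i / scale κ i) / scale κ i) := by
  have hlog : (fun w => Real.log (targetDensity g κ n w))
      = fun w => ∑ j, (Real.log (1 / scale κ j) - g (w j / scale κ j)) := by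
    ext w
    rw [targetDensity, Real.log_prod fun j _ => (mul_pos (one_div_pos.2 (scale_pos κ j))
      (Real.exp_pos _)).ne']
    refine Finset.sum_congr rfl fun j _ => ?_
    rw [Real.log_mul (one_div_pos.2 (scale_pos κ j)).ne' (Real.exp_pos _).ne', Real.log_exp,
      sub_eq_add_neg]
  have hdiff : Differentiable ℝ g := hg.smooth.differentiable (by simp)
  have hfd : HasFDerivAt (fun w : Fin n → ℝ => ∑ j, (Real.log (1 / scale κ j) - g (w j / scale κ j)))
      (∑ j, -((deriv g (x j / scale κ j) / scale κ j) •
        (ContinuousLinearMap.proj j : (Fin n → ℝ) →L[ℝ] ℝ))) x := by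
    refine HasFDerivAt.fun_sum fun j _ => ?_
    have h1 : HasDerivAt (fun y : ℝ => g (y / scale κ j)) (deriv g (x j / scale κ j) / scale κ j)
        (x j) := by
      exact ((hdiff (x j / scale κ j)).hasDerivAt.comp (x j)
        ((hasDerivAt_id (x j)).div_const (scale κ j))).congr_deriv (by simp [div_eq_mul_inv])
    have h2 := h1.comp_hasFDerivAt x (hasFDerivAt_apply (𝕜 := ℝ) j x)
    exact h2.const_sub _
  rw [meanSLA, hlog, hfd.fderiv]
  simp [Pi.single_apply]
  ring

/-- The drift of the Langevin proposal in the rescaled variables. -/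
noncomputable def langevinMean (g : ℝ → ℝ) (ε u : ℝ) : ℝ := u - ε ^ 2 / 2 * deriv g u

lemma measurable_langevinMean (ε : ℝ) :
    Measurable (langevinMean g ε) := by
  have := measurable_deriv g
  unfold langevinMean
  fun_prop

/-- With λ = `scale κ i` and ε = σ/λ, the drift (σ²/2) g'(u)/λ equals λ(ε²/2) g'(u). Rescaling
therefore yields the Langevin proposal of step ε for `exp (-g)`. -/
lemma meanAcceptanceSLA_eq (hg : RegularPotential g) (hσ : 0 < σ) :
    meanAcceptanceSLA g κ n σ = ∫ x, min 1 (Real.exp x)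
      ∂sumLaw fun i : Fin n => ratioLaw g (langevinMean g (σ / scale κ i)) (σ / scale κ i) := by
  refine meanAcceptance_eq hg hσ (fun _ => measurable_langevinMean _) fun u i => ?_
  have := (scale_pos κ i).ne'
  rw [meanSLA_targetDensity hg, langevinMean, mul_div_cancel_left₀ _ this]
  field_simp

end Reduction

/-! ### Polynomial growth, integration by parts and Gaussian moments. -/

/-- At most polynomial growth. -/
def PolyGrowth (h : ℝ → ℝ) : Prop := ∃ (C : ℝ) (m : ℕ), ∀ u : ℝ, |h u| ≤ C * (1 + |u|) ^ m

namespace PolyGrowth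

variable {h k : ℝ → ℝ}

lemma mul (hh : PolyGrowth h) (hk : PolyGrowth k) : PolyGrowth fun u => h u * k u := by
  obtain ⟨C, m, hC⟩ := hh
  obtain ⟨D, n, hD⟩ := hk
  refine ⟨C * D, m + n, fun u => ?_⟩
  rw [abs_mul, pow_add, mul_mul_mul_comm]
  exact mul_le_mul (hC u) (hD u) (abs_nonneg _) ((abs_nonneg _).trans (hC u))

lemma pow (hh : PolyGrowth h) (n : ℕ) : PolyGrowth fun u => h u ^ n := by
  induction n with
  | zero => exact ⟨1, 0, fun u => by simp⟩
  | succ n ih => simpa only [pow_succ] using ih.mul hh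

/-- A common bound for the growth of two functions, with a nonnegative constant. -/
lemma exists_common (hh : PolyGrowth h) (hk : PolyGrowth k) :
    ∃ (C : ℝ) (m : ℕ), 0 ≤ C ∧ (∀ u, |h u| ≤ C * (1 + |u|) ^ m) ∧
      ∀ u, |k u| ≤ C * (1 + |u|) ^ m := by
  obtain ⟨C, m, hC⟩ := hh
  obtain ⟨D, n, hD⟩ := hk
  have one_le (u : ℝ) : 1 ≤ 1 + |u| := by linarith [abs_nonneg u]
  refine ⟨|C| + |D|, m + n, by positivity, fun u => (hC u).trans ?_, fun u => (hD u).trans ?_⟩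
  · exact mul_le_mul ((le_abs_self C).trans (by linarith [abs_nonneg D]))
      (pow_le_pow_right₀ (one_le u) (by omega)) (by positivity) (by positivity)
  · exact mul_le_mul ((le_abs_self D).trans (by linarith [abs_nonneg C]))
      (pow_le_pow_right₀ (one_le u) (by omega)) (by positivity) (by positivity)

lemma add (hh : PolyGrowth h) (hk : PolyGrowth k) : PolyGrowth fun u => h u + k u := by
  obtain ⟨C, m, -, h1, h2⟩ := hh.exists_common hk
  exact ⟨C + C, m, fun u => (abs_add_le _ _).trans (by linarith [h1 u, h2 u])⟩

lemma const (c : ℝ) : PolyGrowth fun _ => c := ⟨|c|, 0, fun u => by simp⟩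

lemma integrable {μ : Measure ℝ} [IsFiniteMeasure μ]
    (hμ : ∀ m : ℕ, Integrable (fun u : ℝ => |u| ^ m) μ) (hc : Continuous h) (hh : PolyGrowth h) :
    Integrable h μ := by
  obtain ⟨C, m, hC⟩ := hh
  refine Integrable.mono' (g := fun u => |C| * (2 ^ (m - 1) * (1 + |u| ^ m)))
    ((((integrable_const 1).add (hμ m)).const_mul _).const_mul _) hc.aestronglyMeasurable
    (ae_of_all _ fun u => (hC u).trans ?_)
  refine mul_le_mul (le_abs_self C) ?_ (by positivity) (abs_nonneg _)
  simpa using add_pow_le zero_le_one (abs_nonneg u) m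

end PolyGrowth

/-- Integration by parts against a density `w` with `w' = -p w`. -/
lemma integral_score_mul {w p h h' : ℝ → ℝ} (hw : ∀ x, HasDerivAt w (-p x * w x) x)
    (hh : ∀ x, HasDerivAt h (h' x) x) (i₁ : Integrable fun x => h x * p x * w x)
    (i₂ : Integrable fun x => h' x * w x) (i₃ : Integrable fun x => h x * w x) :
    ∫ x, h x * p x * w x = ∫ x, h' x * w x := by
  have := integral_mul_deriv_eq_deriv_mul_of_integrable (fun x _ => hh x) (fun x _ => hw x)
    (by
      refine i₁.neg.congr (ae_of_all _ fun x => ?_)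
      simp only [Pi.neg_apply, Pi.mul_apply]
      ring) i₂ i₃
  rw [← neg_inj, ← this, ← integral_neg]
  refine integral_congr_ae (ae_of_all _ fun x => ?_)
  simp only
  ring

lemma integral_linear_comb {E : Type*} [MeasurableSpace E] {μ : Measure E} {f₁ f₂ f₃ : E → ℝ}
    (h₁ : Integrable f₁ μ) (h₂ : Integrable f₂ μ) (h₃ : Integrable f₃ μ) (a b c : ℝ) :
    ∫ x, (a * f₁ x - b * f₂ x + c * f₃ x) ∂μ
      = a * ∫ x, f₁ x ∂μ - b * ∫ x, f₂ x ∂μ + c * ∫ x, f₃ x ∂μ := by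
  have h : Integrable (fun x => a * f₁ x - b * f₂ x) μ := (h₁.const_mul a).sub (h₂.const_mul b)
  rw [integral_add h (h₃.const_mul c), integral_sub (h₁.const_mul a) (h₂.const_mul b),
    integral_const_mul, integral_const_mul, integral_const_mul]

section Gaussian

lemma integrable_abs_pow_gaussianReal (m : ℕ) :
    Integrable (fun z : ℝ => |z| ^ m) (gaussianReal 0 1) := by
  have := (memLp_id_gaussianReal (μ := 0) (v := 1) (m : NNReal))
  simpa using this.integrable_norm_pow'

lemma integrable_pow_gaussianReal (m : ℕ) :
    Integrable (fun z : ℝ => z ^ m) (gaussianReal 0 1) := by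
  refine (integrable_abs_pow_gaussianReal m).mono (by fun_prop) (ae_of_all _ fun z => ?_)
  simp

lemma integrable_pow_mul_gaussianPDFReal (m : ℕ) :
    Integrable (fun z : ℝ => z ^ m * gaussianPDFReal 0 1 z) := by
  have h := integrable_pow_gaussianReal m
  rw [gaussianReal_of_var_ne_zero _ one_ne_zero, integrable_withDensity_iff_integrable_smul'
    (by fun_prop) (by simp [gaussianPDF])] at h
  refine h.congr (ae_of_all _ fun z => ?_)
  simp [gaussianPDF, ENNReal.toReal_ofReal (gaussianPDFReal_nonneg _ _ _), mul_comm]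

/-- Stein's identity: the standard normal density has score z, so z^(m+1) is integrated by parts
against it. -/
lemma integral_pow_gaussianReal_succ (m : ℕ) :
    ∫ z, z ^ (m + 2) ∂gaussianReal 0 1 = (m + 1) * ∫ z, z ^ m ∂gaussianReal 0 1 := by
  have hw : ∀ z : ℝ, HasDerivAt (gaussianPDFReal 0 1) (-z * gaussianPDFReal 0 1 z) z := by
    intro z
    have h1 : HasDerivAt (fun z : ℝ => -(z - 0) ^ 2 / (2 * ((1 : NNReal) : ℝ))) (-z) z := by
      have := ((((hasDerivAt_id z).sub_const 0).pow 2).neg).div_const (2 * ((1 : NNReal) : ℝ))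
      refine this.congr_deriv ?_
      simp
      ring
    exact (h1.exp.const_mul _).congr_deriv (by rw [gaussianPDFReal]; ring)
  have h := integral_score_mul (p := fun z => z) (h := fun z => z ^ (m + 1))
    (h' := fun z => (m + 1) * z ^ m) hw
    (fun x => by simpa using hasDerivAt_pow (m + 1) x)
    ((integrable_pow_mul_gaussianPDFReal (m + 2)).congr (ae_of_all _ fun x => by
      simp only; ring))
    (((integrable_pow_mul_gaussianPDFReal m).const_mul (m + 1)).congr (ae_of_all _ fun x => by
      simp only; ring))
    (integrable_pow_mul_gaussianPDFReal (m + 1))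
  rw [integral_gaussianReal_eq_integral_smul one_ne_zero,
    integral_gaussianReal_eq_integral_smul one_ne_zero, ← integral_const_mul]
  refine Eq.trans (integral_congr_ae (ae_of_all _ fun x => ?_))
    (h.trans (integral_congr_ae (ae_of_all _ fun x => ?_)))
  · simp only [smul_eq_mul]; ring
  · simp only [smul_eq_mul]; ring

lemma integral_sq_gaussianReal : ∫ z, z ^ 2 ∂gaussianReal 0 1 = 1 := by
  simpa using integral_pow_gaussianReal_succ 0

lemma integral_pow_four_gaussianReal : ∫ z, z ^ 4 ∂gaussianReal 0 1 = 3 := by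
  rw [integral_pow_gaussianReal_succ 2, integral_sq_gaussianReal]
  norm_num

lemma integral_pow_six_gaussianReal : ∫ z, z ^ 6 ∂gaussianReal 0 1 = 15 := by
  rw [integral_pow_gaussianReal_succ 4, integral_pow_four_gaussianReal]
  norm_num

end Gaussian

/-! ### The constants: second moments of the leading coefficients, and positivity. -/

namespace RegularPotential

variable {g : ℝ → ℝ}

lemma hasDerivAt_iteratedDeriv (hg : RegularPotential g) (k : ℕ) (x : ℝ) :
    HasDerivAt (iteratedDeriv k g) (iteratedDeriv (k + 1) g x) x := by
  rw [iteratedDeriv_succ]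
  exact (hg.smooth.differentiable_iteratedDeriv k
    (WithTop.coe_lt_coe.2 (WithTop.coe_lt_top _)) x).hasDerivAt

lemma hasDerivAt (hg : RegularPotential g) (x : ℝ) : HasDerivAt g (iteratedDeriv 1 g x) x := by
  simpa using hg.hasDerivAt_iteratedDeriv 0 x

lemma continuous_iteratedDeriv (hg : RegularPotential g) (k : ℕ) :
    Continuous (iteratedDeriv k g) :=
  continuous_iff_continuousAt.2 fun x => (hg.hasDerivAt_iteratedDeriv k x).continuousAt

lemma integrable_baseLaw_iff (hg : RegularPotential g) {h : ℝ → ℝ} :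
    Integrable h (baseLaw g) ↔ Integrable fun u => h u * Real.exp (-g u) := by
  have := hg.smooth.continuous
  rw [baseLaw, integrable_withDensity_iff_integrable_smul' (by fun_prop) (by simp)]
  refine integrable_congr (ae_of_all _ fun u => ?_)
  simp [ENNReal.toReal_ofReal (Real.exp_pos _).le, mul_comm]

lemma integral_baseLaw (hg : RegularPotential g) (h : ℝ → ℝ) :
    ∫ u, h u ∂baseLaw g = ∫ u, h u * Real.exp (-g u) := by
  have := hg.smooth.continuous
  rw [baseLaw, integral_withDensity_eq_integral_toReal_smul (by fun_prop) (by simp)]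
  refine integral_congr_ae (ae_of_all _ fun u => ?_)
  simp [ENNReal.toReal_ofReal (Real.exp_pos _).le, mul_comm]

lemma integrable_of_polyGrowth (hg : RegularPotential g) {h : ℝ → ℝ} (hc : Continuous h)
    (hh : PolyGrowth h) : Integrable h (baseLaw g) :=
  have := hg.isProbabilityMeasure_baseLaw
  hh.integrable (fun m => hg.integrable_baseLaw_iff.2 (hg.moments m)) hc

lemma polyGrowth_iteratedDeriv (hg : RegularPotential g) {k : ℕ} (hk : 1 ≤ k) :
    PolyGrowth (iteratedDeriv k g) := hg.growth k hk

/-- Integration by parts against `exp (-g)`. -/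
lemma integral_mul_deriv_baseLaw (hg : RegularPotential g) {h h' : ℝ → ℝ}
    (hh : ∀ x, HasDerivAt h (h' x) x) (hc' : Continuous h') (p : PolyGrowth h)
    (p' : PolyGrowth h') :
    ∫ u, h u * iteratedDeriv 1 g u ∂baseLaw g = ∫ u, h' u ∂baseLaw g := by
  have hc : Continuous h := continuous_iff_continuousAt.2 fun x => (hh x).continuousAt
  rw [hg.integral_baseLaw, hg.integral_baseLaw]
  refine integral_score_mul (fun x => ?_) hh
    (hg.integrable_baseLaw_iff.1 (hg.integrable_of_polyGrowth
      (hc.mul (hg.continuous_iteratedDeriv 1)) (p.mul (hg.polyGrowth_iteratedDeriv le_rfl))))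
    (hg.integrable_baseLaw_iff.1 (hg.integrable_of_polyGrowth hc' p'))
    (hg.integrable_baseLaw_iff.1 (hg.integrable_of_polyGrowth hc p))
  exact (hg.hasDerivAt x).neg.exp.congr_deriv (mul_comm _ _)

lemma eq_zero_of_integral_eq_zero (hg : RegularPotential g) {h : ℝ → ℝ} (hc : Continuous h)
    (h0 : ∀ x, 0 ≤ h x) (hi : Integrable h (baseLaw g)) (hz : ∫ u, h u ∂baseLaw g = 0) (x : ℝ) :
    h x = 0 := by
  have hgc := hg.smooth.continuous
  have hcont : Continuous fun u => h u * Real.exp (-g u) := hc.mul (by fun_prop)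
  rw [hg.integral_baseLaw, integral_eq_zero_iff_of_nonneg
    (fun u => mul_nonneg (h0 u) (Real.exp_pos _).le) (hg.integrable_baseLaw_iff.1 hi)] at hz
  have := congrFun ((Continuous.ae_eq_iff_eq volume hcont continuous_const).1 hz) x
  exact (mul_eq_zero.1 this).resolve_right (Real.exp_pos _).ne'

lemma constRWM_eq (hg : RegularPotential g) :
    constRWM g = ∫ u, iteratedDeriv 1 g u ^ 2 ∂baseLaw g := by
  rw [hg.integral_baseLaw, constRWM, iteratedDeriv_one]

/-- If the integral vanished, g' would be 0 everywhere and `exp (-g)` a positive constant, which is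
not integrable on ℝ. -/
lemma constRWM_pos (hg : RegularPotential g) : 0 < constRWM g := by
  rw [hg.constRWM_eq]
  refine lt_of_le_of_ne (integral_nonneg fun u => sq_nonneg _) fun h => ?_
  have hz := hg.eq_zero_of_integral_eq_zero ((hg.continuous_iteratedDeriv 1).pow 2)
    (fun x => sq_nonneg _) (hg.integrable_of_polyGrowth ((hg.continuous_iteratedDeriv 1).pow 2)
      ((hg.polyGrowth_iteratedDeriv le_rfl).pow 2)) h.symm
  have hconst : ∀ x, g x = g 0 := fun x =>
    is_const_of_deriv_eq_zero (fun x => (hg.hasDerivAt x).differentiableAt)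
      (fun x => by
        rw [(hg.hasDerivAt x).deriv]
        simpa using hz x) x 0
  have hi := hg.integrable_exp_neg
  simp_rw [hconst] at hi
  rw [integrable_const_iff] at hi
  rcases hi with hi | hi
  · exact (Real.exp_pos _).ne' hi
  · exact absurd hi.measure_univ_lt_top (by simp)

/-- The leading coefficient of the log-ratio of the Langevin proposal. -/
noncomputable def _root_.MHScaling.langevinCoeff (g : ℝ → ℝ) (w : ℝ × ℝ) : ℝ :=
  w.2 ^ 3 * iteratedDeriv 3 g w.1 / 12 - w.2 * (iteratedDeriv 1 g w.1 * iteratedDeriv 2 g w.1) / 4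

/-- Integration by parts of g'(g'')² against the score g'. This is how the cubic term (g'')³ of the
Langevin constant arises. -/
lemma integral_cross (hg : RegularPotential g) :
    ∫ u, (iteratedDeriv 1 g u * iteratedDeriv 2 g u) ^ 2 ∂baseLaw g
      = ∫ u, iteratedDeriv 2 g u ^ 3 ∂baseLaw g
        + 2 * ∫ u, iteratedDeriv 3 g u * (iteratedDeriv 1 g u * iteratedDeriv 2 g u) ∂baseLaw g := by
  have c1 := hg.continuous_iteratedDeriv 1
  have c2 := hg.continuous_iteratedDeriv 2
  have c3 := hg.continuous_iteratedDeriv 3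
  have p1 := hg.polyGrowth_iteratedDeriv (k := 1) (by norm_num)
  have p2 := hg.polyGrowth_iteratedDeriv (k := 2) (by norm_num)
  have p3 := hg.polyGrowth_iteratedDeriv (k := 3) (by norm_num)
  have h := hg.integral_mul_deriv_baseLaw
    (h := fun u => iteratedDeriv 1 g u * iteratedDeriv 2 g u ^ 2)
    (h' := fun u => iteratedDeriv 2 g u ^ 3
      + 2 * (iteratedDeriv 3 g u * (iteratedDeriv 1 g u * iteratedDeriv 2 g u)))
    (fun x => ((hg.hasDerivAt_iteratedDeriv 1 x).mul
      ((hg.hasDerivAt_iteratedDeriv 2 x).pow 2)).congr_deriv (by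
        simp only [Nat.cast_ofNat, Nat.reduceAdd, Nat.add_one_sub_one, pow_one, Pi.pow_apply]
        ring))
    (by fun_prop) (p1.mul (p2.pow 2))
    ((p2.pow 3).add ((PolyGrowth.const 2).mul (p3.mul (p1.mul p2))))
  rw [integral_add (hg.integrable_of_polyGrowth (by fun_prop) (p2.pow 3))
    ((hg.integrable_of_polyGrowth (by fun_prop) (p3.mul (p1.mul p2))).const_mul 2),
    integral_const_mul] at h
  rw [← h]
  refine integral_congr_ae (ae_of_all _ fun u => ?_)
  simp only
  ring

lemma constSLA_eq (hg : RegularPotential g) :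
    constSLA g = ∫ u, (5 / 48 * iteratedDeriv 3 g u ^ 2
      - 1 / 8 * (iteratedDeriv 3 g u * (iteratedDeriv 1 g u * iteratedDeriv 2 g u))
      + 1 / 16 * (iteratedDeriv 1 g u * iteratedDeriv 2 g u) ^ 2) ∂baseLaw g := by
  have c1 := hg.continuous_iteratedDeriv 1
  have c2 := hg.continuous_iteratedDeriv 2
  have c3 := hg.continuous_iteratedDeriv 3
  have p1 := hg.polyGrowth_iteratedDeriv (k := 1) (by norm_num)
  have p2 := hg.polyGrowth_iteratedDeriv (k := 2) (by norm_num)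
  have p3 := hg.polyGrowth_iteratedDeriv (k := 3) (by norm_num)
  have i1 := hg.integrable_of_polyGrowth (by fun_prop) (p3.pow 2)
  have i2 := hg.integrable_of_polyGrowth (by fun_prop) (p3.mul (p1.mul p2))
  have i3 := hg.integrable_of_polyGrowth (by fun_prop) ((p1.mul p2).pow 2)
  have i4 := hg.integrable_of_polyGrowth (by fun_prop) (p2.pow 3)
  rw [integral_linear_comb i1 i2 i3, hg.integral_cross, constSLA, ← hg.integral_baseLaw,
    integral_add (i4.const_mul _) (i1.const_mul _), integral_const_mul, integral_const_mul]
  ring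

/-- The integrand of `constSLA_eq` is [(g'g'' - g''')² + (2/3)(g''')²]/16. If its integral vanishes,
then g''' = 0 and g'g'' = 0, so g'' is constant. A nonzero constant would force g' = 0 and hence g''
= 0, so g'' = 0 in all cases. -/
lemma constSLA_pos (hg : RegularPotential g) : 0 < constSLA g := by
  have c1 := hg.continuous_iteratedDeriv 1
  have c2 := hg.continuous_iteratedDeriv 2
  have c3 := hg.continuous_iteratedDeriv 3
  have p1 := hg.polyGrowth_iteratedDeriv (k := 1) (by norm_num)
  have p2 := hg.polyGrowth_iteratedDeriv (k := 2) (by norm_num)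
  have p3 := hg.polyGrowth_iteratedDeriv (k := 3) (by norm_num)
  have e : constSLA g = (∫ u, ((iteratedDeriv 1 g u * iteratedDeriv 2 g u
      + -1 * iteratedDeriv 3 g u) ^ 2 + 2 / 3 * iteratedDeriv 3 g u ^ 2) ∂baseLaw g) / 16 := by
    rw [hg.constSLA_eq, ← integral_div]
    refine integral_congr_ae (ae_of_all _ fun u => ?_)
    simp only
    ring
  have hnn : ∀ u, 0 ≤ (iteratedDeriv 1 g u * iteratedDeriv 2 g u
      + -1 * iteratedDeriv 3 g u) ^ 2 + 2 / 3 * iteratedDeriv 3 g u ^ 2 := fun u => by positivity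
  rw [e]
  refine div_pos (lt_of_le_of_ne (integral_nonneg hnn) fun h => ?_) (by norm_num)
  have hz := hg.eq_zero_of_integral_eq_zero (by fun_prop) hnn
    (hg.integrable_of_polyGrowth (by fun_prop)
      ((((p1.mul p2).add ((PolyGrowth.const (-1)).mul p3)).pow 2).add
        ((PolyGrowth.const (2 / 3)).mul (p3.pow 2)))) h.symm
  have z3 : ∀ u, iteratedDeriv 3 g u = 0 := fun u => by
    have h1 := hz u
    nlinarith [sq_nonneg (iteratedDeriv 1 g u * iteratedDeriv 2 g u + -1 * iteratedDeriv 3 g u),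
      sq_nonneg (iteratedDeriv 3 g u)]
  have z12 : ∀ u, iteratedDeriv 1 g u * iteratedDeriv 2 g u = 0 := fun u => by
    have h1 := hz u
    rw [z3 u] at h1
    simpa using h1
  have hconst : ∀ x, iteratedDeriv 2 g x = iteratedDeriv 2 g 0 := fun x =>
    is_const_of_deriv_eq_zero (fun x => (hg.hasDerivAt_iteratedDeriv 2 x).differentiableAt)
      (fun x => by rw [(hg.hasDerivAt_iteratedDeriv 2 x).deriv, z3]) x 0
  have z2 : ∀ x, iteratedDeriv 2 g x = 0 := by
    by_contra! hne
    obtain ⟨y, hy⟩ := hne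
    have z1 : iteratedDeriv 1 g = fun _ => 0 := by
      ext u
      refine (mul_eq_zero.1 (z12 u)).resolve_right ?_
      rwa [hconst u, ← hconst y]
    have h2 := hg.hasDerivAt_iteratedDeriv 1 y
    rw [z1] at h2
    exact hy (h2.unique (hasDerivAt_const y (0 : ℝ)))
  -- E[(g')²] = E[g''] = 0 contradicts `constRWM_pos`.
  have hibp := hg.integral_mul_deriv_baseLaw (hg.hasDerivAt_iteratedDeriv 1) c2 p1 p2
  simp only [Nat.reduceAdd, z2, integral_zero, ← sq] at hibp
  exact hg.constRWM_pos.ne' (hg.constRWM_eq.trans hibp)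

lemma integral_rwmCoeff_sq (hg : RegularPotential g) :
    ∫ w, (-(w.2 * iteratedDeriv 1 g w.1)) ^ 2 ∂((baseLaw g).prod (gaussianReal 0 1))
      = constRWM g := by
  have := hg.isProbabilityMeasure_baseLaw
  have e := integral_prod_mul (μ := baseLaw g) (ν := gaussianReal 0 1)
    (fun u => iteratedDeriv 1 g u ^ 2) (fun z => z ^ 2)
  rw [integral_sq_gaussianReal, mul_one, ← hg.constRWM_eq] at e
  rw [← e]
  refine integral_congr_ae (ae_of_all _ fun u => ?_)
  simp only
  ring

/-- State and noise are independent, and the normal moments 15, 3, 1 of orders 6, 4, 2 turn the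
coefficients 1/144, 1/24, 1/16 into 5/48, 1/8, 1/16. -/
lemma integral_langevinCoeff_sq (hg : RegularPotential g) :
    ∫ w, langevinCoeff g w ^ 2 ∂((baseLaw g).prod (gaussianReal 0 1)) = constSLA g := by
  have := hg.isProbabilityMeasure_baseLaw
  have c1 := hg.continuous_iteratedDeriv 1
  have c2 := hg.continuous_iteratedDeriv 2
  have c3 := hg.continuous_iteratedDeriv 3
  have p1 := hg.polyGrowth_iteratedDeriv (k := 1) (by norm_num)
  have p2 := hg.polyGrowth_iteratedDeriv (k := 2) (by norm_num)
  have p3 := hg.polyGrowth_iteratedDeriv (k := 3) (by norm_num)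
  have i1 := hg.integrable_of_polyGrowth (by fun_prop) (p3.pow 2)
  have i2 := hg.integrable_of_polyGrowth (by fun_prop) (p3.mul (p1.mul p2))
  have i3 := hg.integrable_of_polyGrowth (by fun_prop) ((p1.mul p2).pow 2)
  have e6 := integral_prod_mul (μ := baseLaw g) (ν := gaussianReal 0 1)
    (fun u => iteratedDeriv 3 g u ^ 2) (fun z => z ^ 6)
  have e4 := integral_prod_mul (μ := baseLaw g) (ν := gaussianReal 0 1)
    (fun u => iteratedDeriv 3 g u * (iteratedDeriv 1 g u * iteratedDeriv 2 g u)) (fun z => z ^ 4)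
  have e2 := integral_prod_mul (μ := baseLaw g) (ν := gaussianReal 0 1)
    (fun u => (iteratedDeriv 1 g u * iteratedDeriv 2 g u) ^ 2) (fun z => z ^ 2)
  have j6 := i1.mul_prod (integrable_pow_gaussianReal 6)
  have j4 := i2.mul_prod (integrable_pow_gaussianReal 4)
  have j2 := i3.mul_prod (integrable_pow_gaussianReal 2)
  have e : ∀ w : ℝ × ℝ, langevinCoeff g w ^ 2 = 1 / 144 * (iteratedDeriv 3 g w.1 ^ 2 * w.2 ^ 6)
      - 1 / 24 * (iteratedDeriv 3 g w.1 * (iteratedDeriv 1 g w.1 * iteratedDeriv 2 g w.1) * w.2 ^ 4)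
      + 1 / 16 * ((iteratedDeriv 1 g w.1 * iteratedDeriv 2 g w.1) ^ 2 * w.2 ^ 2) := by
    intro w
    rw [langevinCoeff]
    ring
  simp_rw [e]
  rw [integral_linear_comb j6 j4 j2, e6, e4, e2, integral_pow_six_gaussianReal, integral_pow_four_gaussianReal,
    integral_sq_gaussianReal, hg.constSLA_eq, integral_linear_comb i1 i2 i3]
  ring

end RegularPotential

/-! ### Exact expansions of the log-ratios and their domination. -/

/-- Mean value theorem without an order assumption on the endpoints. -/
lemma exists_mean_value {f f' : ℝ → ℝ} (hf : ∀ x, HasDerivAt f (f' x) x) (u v : ℝ) :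
    ∃ ξ ∈ Set.uIcc u v, f v - f u = f' ξ * (v - u) := by
  wlog huv : u ≤ v generalizing u v
  · obtain ⟨ξ, hξ, h⟩ := this v u (le_of_not_ge huv)
    exact ⟨ξ, Set.uIcc_comm u v ▸ hξ, by linarith⟩
  rcases huv.eq_or_lt with rfl | huv
  · exact ⟨u, by simp, by simp⟩
  obtain ⟨ξ, hξ, h⟩ := exists_hasDerivAt_eq_slope f f' huv
    (fun x _ => (hf x).continuousAt.continuousWithinAt) fun x _ => hf x
  refine ⟨ξ, Set.Icc_subset_uIcc (Set.Ioo_subset_Icc_self hξ), ?_⟩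
  rw [h, div_mul_cancel₀ _ (sub_ne_zero.2 huv.ne')]

/-- The error of the trapezoidal rule. -/
lemma exists_trapezoid_error {f f₁ f₂ f₃ : ℝ → ℝ} (h₁ : ∀ x, HasDerivAt f (f₁ x) x)
    (h₂ : ∀ x, HasDerivAt f₁ (f₂ x) x) (h₃ : ∀ x, HasDerivAt f₂ (f₃ x) x) (u v : ℝ) :
    ∃ ξ ∈ Set.uIcc u v,
      f u - f v + (v - u) * (f₁ u + f₁ v) / 2 = (v - u) ^ 3 / 12 * f₃ ξ := by
  wlog huv : u ≤ v generalizing u v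
  · obtain ⟨ξ, hξ, h⟩ := this v u (le_of_not_ge huv)
    exact ⟨ξ, Set.uIcc_comm u v ▸ hξ, by linear_combination -h⟩
  rcases huv.eq_or_lt with rfl | huv
  · exact ⟨u, by simp, by simp⟩
  -- M is chosen so that G below vanishes at both u and v. Its derivative G₁ also vanishes at u, so
  -- Rolle applies twice and yields M = f₃(ξ)/12.
  set M : ℝ := (f u - f v + (v - u) * (f₁ u + f₁ v) / 2) / (v - u) ^ 3 with hM
  have hne : (v - u) ^ 3 ≠ 0 := pow_ne_zero _ (sub_ne_zero.2 huv.ne')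
  set G : ℝ → ℝ := fun x => f u - f x + (x - u) * (f₁ u + f₁ x) / 2 - M * (x - u) ^ 3 with hG
  set G₁ : ℝ → ℝ := fun x => (f₁ u - f₁ x) / 2 + (x - u) * f₂ x / 2 - 3 * M * (x - u) ^ 2 with hG₁
  have d1 : ∀ x, HasDerivAt G (G₁ x) x := fun x => by
    have hx : HasDerivAt (fun x => x - u) 1 x := (hasDerivAt_id x).sub_const u
    refine ((((h₁ x).const_sub (f u)).add
      ((hx.mul ((h₂ x).const_add (f₁ u))).div_const 2)).sub
      ((hx.pow 3).const_mul M)).congr_deriv ?_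
    simp only [hG₁]
    norm_num
    ring
  have d2 : ∀ x, HasDerivAt G₁ ((x - u) * (f₃ x / 2 - 6 * M)) x := fun x => by
    have hx : HasDerivAt (fun x => x - u) 1 x := (hasDerivAt_id x).sub_const u
    refine (((((h₂ x).const_sub (f₁ u)).div_const 2).add
      ((hx.mul (h₃ x)).div_const 2)).sub ((hx.pow 2).const_mul (3 * M))).congr_deriv ?_
    norm_num
    ring
  have G0 : G u = 0 := by simp [hG]
  have Gv : G v = 0 := by simp only [hG, hM]; rw [div_mul_cancel₀ _ hne, sub_self]
  obtain ⟨c, hc, hc'⟩ := exists_hasDerivAt_eq_zero huv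
    (fun x _ => (d1 x).continuousAt.continuousWithinAt) (G0.trans Gv.symm) fun x _ => d1 x
  obtain ⟨ξ, hξ, hξ'⟩ := exists_hasDerivAt_eq_zero hc.1
    (fun x _ => (d2 x).continuousAt.continuousWithinAt)
    ((by simp [hG₁] : G₁ u = 0).trans hc'.symm) fun x _ => d2 x
  refine ⟨ξ, Set.Icc_subset_uIcc ⟨hξ.1.le, (hξ.2.trans hc.2).le⟩, ?_⟩
  have h6 : f₃ ξ / 2 - 6 * M = 0 :=
    (mul_eq_zero.1 hξ').resolve_left (sub_ne_zero.2 hξ.1.ne')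
  have h7 : M = f₃ ξ / 12 := by linarith
  rw [hM, div_eq_iff hne] at h7
  rw [h7]
  ring

/-- A majorant of the relevant points and increments of one step of either algorithm. -/
noncomputable def stepBound (g : ℝ → ℝ) (w : ℝ × ℝ) : ℝ :=
  1 + |w.1| + |iteratedDeriv 1 g w.1| + |w.2|

lemma one_le_stepBound (g : ℝ → ℝ) (w : ℝ × ℝ) : 1 ≤ stepBound g w := by
  unfold stepBound
  have := abs_nonneg w.1
  have := abs_nonneg w.2
  have := abs_nonneg (iteratedDeriv 1 g w.1)
  linarith

lemma tendsto_of_mem_uIcc {α : Type*} {F : Filter α} {u : ℝ} {v ξ : α → ℝ}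
    (hv : Tendsto v F (𝓝 u)) (hξ : ∀ x, ξ x ∈ Set.uIcc u (v x)) : Tendsto ξ F (𝓝 u) := by
  rw [tendsto_iff_norm_sub_tendsto_zero] at hv ⊢
  exact squeeze_zero (fun _ => norm_nonneg _)
    (fun x => Set.abs_sub_left_of_mem_uIcc (hξ x)) hv

namespace RegularPotential

variable {g : ℝ → ℝ}

lemma continuous_stepBound (hg : RegularPotential g) : Continuous (stepBound g) := by
  have := hg.continuous_iteratedDeriv 1
  unfold stepBound
  fun_prop

/-- The bound `stepBound` ≤ (1 + |u| + |g'(u)|)(1 + |z|) separates state and noise. -/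
lemma integrable_stepBound_pow (hg : RegularPotential g) (N : ℕ) :
    Integrable (fun w => stepBound g w ^ N) ((baseLaw g).prod (gaussianReal 0 1)) := by
  have := hg.isProbabilityMeasure_baseLaw
  have c1 := hg.continuous_iteratedDeriv 1
  have q : PolyGrowth fun u : ℝ => 1 + |u| := ⟨1, 1, fun u => by
    rw [abs_of_nonneg (by positivity)]; simp⟩
  have p : PolyGrowth fun u => 1 + |u| + |iteratedDeriv 1 g u| :=
    q.add (by
      obtain ⟨C, m, h⟩ := hg.polyGrowth_iteratedDeriv (k := 1) le_rfl
      exact ⟨C, m, fun u => by simpa using h u⟩)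
  have i1 := hg.integrable_of_polyGrowth (by fun_prop) (p.pow N)
  have i2 : Integrable (fun z : ℝ => (1 + |z|) ^ N) (gaussianReal 0 1) :=
    (q.pow N).integrable integrable_abs_pow_gaussianReal (by fun_prop)
  have hs := hg.continuous_stepBound
  refine (i1.mul_prod i2).mono' (by fun_prop) (ae_of_all _ fun w => ?_)
  have h0 := one_le_stepBound g w
  rw [Real.norm_eq_abs, abs_of_nonneg (by positivity), ← mul_pow]
  refine pow_le_pow_left₀ (by linarith) ?_ N
  unfold stepBound
  nlinarith [abs_nonneg w.1, abs_nonneg w.2, abs_nonneg (iteratedDeriv 1 g w.1),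
    mul_nonneg (abs_nonneg w.1) (abs_nonneg w.2),
    mul_nonneg (abs_nonneg (iteratedDeriv 1 g w.1)) (abs_nonneg w.2)]

/-- Uniform bound on the derivatives along a step of the algorithm. -/
lemma abs_le_of_mem_uIcc {h : ℝ → ℝ} {C : ℝ} {m : ℕ} (hC : 0 ≤ C)
    (hh : ∀ u, |h u| ≤ C * (1 + |u|) ^ m) {w : ℝ × ℝ} {v ξ : ℝ}
    (hv : |v - w.1| ≤ |iteratedDeriv 1 g w.1| + |w.2|) (hξ : ξ ∈ Set.uIcc w.1 v) :
    |h ξ| ≤ C * stepBound g w ^ m := by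
  refine (hh ξ).trans (mul_le_mul_of_nonneg_left (pow_le_pow_left₀ (by positivity) ?_ m) hC)
  have h1 := Set.abs_sub_left_of_mem_uIcc hξ
  have h2 := abs_sub_abs_le_abs_sub ξ w.1
  unfold stepBound
  linarith

/-- The log-ratio of the random walk. -/
lemma exists_noiseLogRatio_rwm (hg : RegularPotential g) (ε : ℝ) (w : ℝ × ℝ) :
    ∃ ξ ∈ Set.uIcc w.1 (w.1 + ε * w.2),
      noiseLogRatio g (fun u => u) ε w = ε * -(w.2 * iteratedDeriv 1 g ξ) := by
  obtain ⟨ξ, hξ, h⟩ := exists_mean_value hg.hasDerivAt w.1 (w.1 + ε * w.2)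
  refine ⟨ξ, hξ, ?_⟩
  simp only [noiseLogRatio, logRatio]
  -- The proposal is symmetric, so the Gaussian terms cancel and only an increment of g remains.
  rw [show (w.1 - (w.1 + ε * w.2)) ^ 2 = (w.1 + ε * w.2 - w.1) ^ 2 by ring, sub_self, zero_div]
  linear_combination -h

lemma quadraticScaling_rwm (hg : RegularPotential g) :
    QuadraticScaling (ratioLaw g fun u => u) 1 (constRWM g) := by
  obtain ⟨C, m, hC, hb, -⟩ := (hg.polyGrowth_iteratedDeriv (k := 1) le_rfl).exists_common
    (PolyGrowth.const 0)
  rw [← hg.integral_rwmCoeff_sq]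
  refine quadraticScaling_map (P := fun w => C * stepBound g w ^ (m + 1)) one_ne_zero
    (fun ε _ => measurable_noiseLogRatio hg.smooth.continuous.measurable measurable_id ε) ?_ ?_ ?_
  · refine ((hg.integrable_stepBound_pow ((m + 1) * 2)).const_mul (C ^ 2)).congr
      (ae_of_all _ fun w => ?_)
    simp only
    ring
  · intro ε hε hε1 w
    obtain ⟨ξ, hξ, h⟩ := hg.exists_noiseLogRatio_rwm ε w
    have hv : |w.1 + ε * w.2 - w.1| ≤ |iteratedDeriv 1 g w.1| + |w.2| := by
      rw [add_sub_cancel_left, abs_mul, abs_of_pos hε]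
      nlinarith [abs_nonneg w.2, abs_nonneg (iteratedDeriv 1 g w.1)]
    have h1 := abs_le_of_mem_uIcc hC hb hv hξ
    have h2 : |w.2| ≤ stepBound g w := by
      unfold stepBound
      linarith [abs_nonneg w.1, abs_nonneg (iteratedDeriv 1 g w.1)]
    rw [h, abs_mul, abs_of_pos hε, abs_neg, abs_mul, pow_one]
    refine mul_le_mul_of_nonneg_left ?_ hε.le
    calc _ ≤ stepBound g w * (C * stepBound g w ^ m) :=
          mul_le_mul h2 h1 (abs_nonneg _) ((abs_nonneg _).trans h2)
      _ = _ := by ring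
  · intro w
    choose ξ hξ h using fun ε => hg.exists_noiseLogRatio_rwm ε w
    have hv : Tendsto (fun ε : ℝ => w.1 + ε * w.2) (𝓝[>] 0) (𝓝 w.1) := by
      have : Continuous fun ε : ℝ => w.1 + ε * w.2 := by fun_prop
      simpa using (this.tendsto 0).mono_left nhdsWithin_le_nhds
    have hlim := ((hg.continuous_iteratedDeriv 1).tendsto w.1).comp (tendsto_of_mem_uIcc hv hξ)
    refine ((hlim.const_mul w.2).neg).congr' ?_
    filter_upwards [self_mem_nhdsWithin] with ε hε
    rw [h, pow_one, mul_div_cancel_left₀ _ (ne_of_gt hε)]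
    rfl

/-- The log-ratio of the Langevin proposal. -/
lemma exists_noiseLogRatio_langevin (hg : RegularPotential g) {ε : ℝ} (hε : 0 < ε) (w : ℝ × ℝ) :
    ∃ ξ ∈ Set.uIcc w.1 (langevinMean g ε w.1 + ε * w.2),
      ∃ η ∈ Set.uIcc w.1 (langevinMean g ε w.1 + ε * w.2),
      noiseLogRatio g (langevinMean g ε) ε w = ε ^ 3 *
        ((w.2 - ε / 2 * iteratedDeriv 1 g w.1) ^ 3 * iteratedDeriv 3 g ξ / 12
          - (w.2 - ε / 2 * iteratedDeriv 1 g w.1)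
            * (iteratedDeriv 1 g η * iteratedDeriv 2 g η) / 4) := by
  set v := langevinMean g ε w.1 + ε * w.2 with hv
  obtain ⟨ξ, hξ, h⟩ := exists_trapezoid_error hg.hasDerivAt (hg.hasDerivAt_iteratedDeriv 1)
    (hg.hasDerivAt_iteratedDeriv 2) w.1 v
  obtain ⟨η, hη, h'⟩ := exists_mean_value
    (f' := fun x => 2 * (iteratedDeriv 1 g x * iteratedDeriv 2 g x))
    (fun x => ((hg.hasDerivAt_iteratedDeriv 1 x).pow 2).congr_deriv (by norm_num; ring)) w.1 v
  refine ⟨ξ, hξ, η, hη, ?_⟩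
  have hd : v - w.1 = ε * (w.2 - ε / 2 * iteratedDeriv 1 g w.1) := by
    rw [hv, langevinMean, iteratedDeriv_one]
    ring
  -- The drift supplies exactly the trapezoidal approximation of the increment of g. What remains is
  -- cubic in v - u, or ε² times an increment of (g')², hence of order ε³ since v - u is of order ε.
  have e : noiseLogRatio g (langevinMean g ε) ε w
      = g w.1 - g v + (v - w.1) * (iteratedDeriv 1 g w.1 + iteratedDeriv 1 g v) / 2
        - ε ^ 2 / 8 * (iteratedDeriv 1 g v ^ 2 - iteratedDeriv 1 g w.1 ^ 2) := by
    rw [noiseLogRatio, ← hv, logRatio, langevinMean, langevinMean, iteratedDeriv_one]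
    field_simp
    ring
  simp only [Pi.pow_apply] at h'
  rw [e, h, h', hd]
  ring

lemma quadraticScaling_langevin (hg : RegularPotential g) :
    QuadraticScaling (fun ε => ratioLaw g (langevinMean g ε) ε) 3 (constSLA g) := by
  obtain ⟨C, m, hC, hb, hb'⟩ := (hg.polyGrowth_iteratedDeriv (k := 3) (by norm_num)).exists_common
    ((hg.polyGrowth_iteratedDeriv (k := 1) le_rfl).mul
      (hg.polyGrowth_iteratedDeriv (k := 2) (by norm_num)))
  rw [← hg.integral_langevinCoeff_sq]
  refine quadraticScaling_map (P := fun w => C * stepBound g w ^ (m + 3)) (by norm_num)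
    (fun ε _ => measurable_noiseLogRatio hg.smooth.continuous.measurable
      (measurable_langevinMean ε) ε) ?_ ?_ ?_
  · refine ((hg.integrable_stepBound_pow ((m + 3) * 2)).const_mul (C ^ 2)).congr
      (ae_of_all _ fun w => ?_)
    simp only
    ring
  · intro ε hε hε1 w
    obtain ⟨ξ, hξ, η, hη, h⟩ := hg.exists_noiseLogRatio_langevin hε w
    set y := w.2 - ε / 2 * iteratedDeriv 1 g w.1 with hy
    have hyb : |y| ≤ |iteratedDeriv 1 g w.1| + |w.2| := by
      have h1 := abs_sub w.2 (ε / 2 * iteratedDeriv 1 g w.1)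
      rw [abs_mul, abs_of_pos (half_pos hε)] at h1
      nlinarith [abs_nonneg (iteratedDeriv 1 g w.1)]
    have hv : |langevinMean g ε w.1 + ε * w.2 - w.1| ≤ |iteratedDeriv 1 g w.1| + |w.2| := by
      have : langevinMean g ε w.1 + ε * w.2 - w.1 = ε * y := by
        rw [langevinMean, hy, iteratedDeriv_one]
        ring
      rw [this, abs_mul, abs_of_pos hε]
      nlinarith [abs_nonneg y]
    have h1 := abs_le_of_mem_uIcc hC hb hv hξ
    have h2 := abs_le_of_mem_uIcc hC hb' hv hη
    have h3 : |y| ≤ stepBound g w := by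
      unfold stepBound
      linarith [abs_nonneg w.1]
    have h0 := one_le_stepBound g w
    rw [h, abs_mul, abs_of_pos (pow_pos hε 3)]
    refine mul_le_mul_of_nonneg_left ?_ (pow_pos hε 3).le
    have t1 : |y ^ 3 * iteratedDeriv 3 g ξ| ≤ stepBound g w ^ 3 * (C * stepBound g w ^ m) := by
      rw [abs_mul, abs_pow]
      exact mul_le_mul (pow_le_pow_left₀ (abs_nonneg _) h3 3) h1 (abs_nonneg _) (by positivity)
    have t2 : |y * (iteratedDeriv 1 g η * iteratedDeriv 2 g η)|
        ≤ stepBound g w ^ 3 * (C * stepBound g w ^ m) := by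
      rw [abs_mul]
      exact mul_le_mul (h3.trans (le_self_pow₀ h0 (by norm_num))) h2 (abs_nonneg _) (by positivity)
    have t3 := abs_sub (y ^ 3 * iteratedDeriv 3 g ξ / 12)
      (y * (iteratedDeriv 1 g η * iteratedDeriv 2 g η) / 4)
    rw [abs_div, abs_div, abs_of_pos (by norm_num : (0 : ℝ) < 12),
      abs_of_pos (by norm_num : (0 : ℝ) < 4)] at t3
    have t4 : stepBound g w ^ 3 * (C * stepBound g w ^ m) = C * stepBound g w ^ (m + 3) := by ring
    have t5 : 0 ≤ C * stepBound g w ^ (m + 3) := by positivity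
    linarith
  · intro w
    -- The expansion is only available for ε > 0; elsewhere the intermediate points default to
    -- `w.1`, so that they can be chosen as functions on all of ℝ.
    have hex : ∀ ε : ℝ, ∃ ξ η, ξ ∈ Set.uIcc w.1 (langevinMean g ε w.1 + ε * w.2) ∧
        η ∈ Set.uIcc w.1 (langevinMean g ε w.1 + ε * w.2) ∧ (0 < ε →
        noiseLogRatio g (langevinMean g ε) ε w = ε ^ 3 *
        ((w.2 - ε / 2 * iteratedDeriv 1 g w.1) ^ 3 * iteratedDeriv 3 g ξ / 12
          - (w.2 - ε / 2 * iteratedDeriv 1 g w.1)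
            * (iteratedDeriv 1 g η * iteratedDeriv 2 g η) / 4)) := by
      intro ε
      by_cases hε : 0 < ε
      · obtain ⟨ξ, hξ, η, hη, h⟩ := hg.exists_noiseLogRatio_langevin hε w
        exact ⟨ξ, η, hξ, hη, fun _ => h⟩
      · exact ⟨w.1, w.1, Set.left_mem_uIcc, Set.left_mem_uIcc, fun h => absurd h hε⟩
    choose ξ η hξ hη h using hex
    have hv : Tendsto (fun ε : ℝ => langevinMean g ε w.1 + ε * w.2) (𝓝[>] 0) (𝓝 w.1) := by
      have : Continuous fun ε : ℝ => langevinMean g ε w.1 + ε * w.2 := by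
        unfold langevinMean
        fun_prop
      simpa [langevinMean] using (this.tendsto 0).mono_left nhdsWithin_le_nhds
    have hy : Tendsto (fun ε : ℝ => w.2 - ε / 2 * iteratedDeriv 1 g w.1) (𝓝[>] 0) (𝓝 w.2) := by
      have : Continuous fun ε : ℝ => w.2 - ε / 2 * iteratedDeriv 1 g w.1 := by fun_prop
      simpa using (this.tendsto 0).mono_left nhdsWithin_le_nhds
    have l3 := ((hg.continuous_iteratedDeriv 3).tendsto w.1).comp (tendsto_of_mem_uIcc hv hξ)
    have l12 := (((hg.continuous_iteratedDeriv 1).mul (hg.continuous_iteratedDeriv 2)).tendsto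
      w.1).comp (tendsto_of_mem_uIcc hv hη)
    refine ((((hy.pow 3).mul l3).div_const 12).sub ((hy.mul l12).div_const 4)).congr' ?_
    filter_upwards [self_mem_nhdsWithin] with ε hε
    rw [h ε hε, mul_div_cancel_left₀ _ (pow_ne_zero 3 (ne_of_gt hε))]
    rfl

end RegularPotential

/-! ### Sums of powers of the steps and the three regimes. -/

lemma sum_rpow_bounds {s : ℝ} (hs : 0 ≤ s) (n : ℕ) :
    (n : ℝ) ^ (s + 1) / (s + 1) ≤ ∑ i : Fin n, ((i : ℝ) + 1) ^ s ∧
      ∑ i : Fin n, ((i : ℝ) + 1) ^ s ≤ (n : ℝ) ^ (s + 1) / (s + 1) + (n : ℝ) ^ s := by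
  have hmono : MonotoneOn (fun x : ℝ => x ^ s) (Set.Icc 0 (0 + (n : ℝ))) :=
    fun x hx y _ hxy => Real.rpow_le_rpow hx.1 hxy hs
  have hint : ∫ x in (0 : ℝ)..0 + n, x ^ s = (n : ℝ) ^ (s + 1) / (s + 1) := by
    rw [integral_rpow (Or.inl (by linarith)), Real.zero_rpow (by linarith), sub_zero, zero_add]
  have h1 := hmono.integral_le_sum
  have h2 := hmono.sum_le_integral
  rw [hint] at h1 h2
  rw [Fin.sum_univ_eq_sum_range (fun i : ℕ => ((i : ℝ) + 1) ^ s)]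
  constructor
  · simpa using h1
  -- The integral dominates the sum over 0, …, n - 1. Shifting the index adds n^s and drops 0^s,
  -- which is 1 if s = 0 but is nonnegative in any case.
  · have h3 := Finset.sum_range_succ (fun i : ℕ => (i : ℝ) ^ s) n
    rw [Finset.sum_range_succ'] at h3
    simp only [zero_add] at h2
    push_cast at h3
    have h4 : (0 : ℝ) ≤ (0 : ℝ) ^ s := Real.rpow_nonneg le_rfl s
    linarith

lemma tendsto_sum_rpow_div {s : ℝ} (hs : 0 ≤ s) :
    Tendsto (fun n : ℕ => (∑ i : Fin n, ((i : ℝ) + 1) ^ s) / (n : ℝ) ^ (s + 1)) atTop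
      (𝓝 (1 / (s + 1))) := by
  have h : Tendsto (fun n : ℕ => 1 / (s + 1) + 1 / (n : ℝ)) atTop (𝓝 (1 / (s + 1))) := by
    simpa using tendsto_one_div_atTop_nhds_zero_nat.const_add (1 / (s + 1))
  refine tendsto_of_tendsto_of_tendsto_of_le_of_le' tendsto_const_nhds h ?_ ?_
  · filter_upwards [eventually_gt_atTop 0] with n hn
    have hp : (0 : ℝ) < (n : ℝ) ^ (s + 1) := by positivity
    rw [le_div_iff₀ hp]
    calc _ = (n : ℝ) ^ (s + 1) / (s + 1) := by ring
      _ ≤ _ := (sum_rpow_bounds hs n).1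
  · filter_upwards [eventually_gt_atTop 0] with n hn
    have hn' : (0 : ℝ) < n := by exact_mod_cast hn
    have hp : (0 : ℝ) < (n : ℝ) ^ (s + 1) := by positivity
    rw [div_le_iff₀ hp]
    refine (sum_rpow_bounds hs n).2.trans (le_of_eq ?_)
    rw [add_mul, Real.rpow_add_one hn'.ne']
    field_simp

section Steps

variable {κ l ρ : ℝ} {σ : ℕ → ℝ}

lemma sum_step_pow (hσ : ∀ n : ℕ, 1 ≤ n → 0 < σ n ∧ σ n ^ 2 = l ^ 2 * (n : ℝ) ^ (-ρ)) (d : ℕ)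
    {n : ℕ} (hn : 1 ≤ n) :
    ∑ i : Fin n, (σ n / scale κ i) ^ (2 * d)
      = l ^ (2 * d) * ((n : ℝ) ^ (1 + 2 * d * κ - d * ρ)
        * ((∑ i : Fin n, ((i : ℝ) + 1) ^ (2 * d * κ)) / (n : ℝ) ^ (2 * d * κ + 1))) := by
  have hn' : (0 : ℝ) < n := by exact_mod_cast hn
  have e1 : (n : ℝ) ^ (1 + 2 * d * κ - d * ρ)
      = ((n : ℝ) ^ (-ρ)) ^ d * (n : ℝ) ^ (2 * d * κ + 1) := by
    rw [← Real.rpow_mul_natCast hn'.le, ← Real.rpow_add hn']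
    congr 1
    ring
  have e2 : ∀ i : Fin n, (σ n / scale κ i) ^ (2 * d)
      = l ^ (2 * d) * ((n : ℝ) ^ (-ρ)) ^ d * ((i : ℝ) + 1) ^ (2 * d * κ) := by
    intro i
    have hi : (0 : ℝ) < (i : ℝ) + 1 := by positivity
    rw [div_pow, pow_mul, (hσ n hn).2, mul_pow, ← pow_mul, scale, div_eq_mul_inv,
      ← Real.rpow_mul_natCast hi.le, ← Real.rpow_neg hi.le]
    congr 2
    push_cast
    ring
  simp_rw [e2]
  rw [← Finset.mul_sum, e1]
  field_simp

/-- The last coordinate has the largest step, of square l² n^(2κ-ρ). This is what ρ > 2κ is for: all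
steps go to 0 uniformly. -/
lemma eventually_step_lt (hκ : 0 ≤ κ)
    (hσ : ∀ n : ℕ, 1 ≤ n → 0 < σ n ∧ σ n ^ 2 = l ^ 2 * (n : ℝ) ^ (-ρ)) (hρ : 2 * κ < ρ)
    {δ : ℝ} (hδ : 0 < δ) : ∀ᶠ n in atTop, ∀ i : Fin n, σ n / scale κ i < δ := by
  have h : Tendsto (fun n : ℕ => l ^ 2 * (n : ℝ) ^ (-(ρ - 2 * κ))) atTop (𝓝 0) := by
    simpa using ((tendsto_rpow_neg_atTop (sub_pos.2 hρ)).comp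
      tendsto_natCast_atTop_atTop).const_mul (l ^ 2)
  filter_upwards [h.eventually_lt_const (pow_pos hδ 2), eventually_ge_atTop 1] with n hlt hn i
  have hn' : (0 : ℝ) < n := by exact_mod_cast hn
  have hi : (0 : ℝ) < (i : ℝ) + 1 := by positivity
  have hin : (i : ℝ) + 1 ≤ n := by exact_mod_cast i.2
  refine lt_of_pow_lt_pow_left₀ 2 hδ.le (lt_of_le_of_lt ?_ hlt)
  rw [div_pow, (hσ n hn).2, scale, div_eq_mul_inv, ← Real.rpow_mul_natCast hi.le,
    ← Real.rpow_neg hi.le, mul_assoc, show -(ρ - 2 * κ) = -ρ + 2 * κ by ring, Real.rpow_add hn']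
  have : -(-κ * ((2 : ℕ) : ℝ)) = 2 * κ := by push_cast; ring
  rw [this]
  gcongr

/-- The three scaling regimes for log-ratios of order `ε ^ d`. -/
theorem QuadraticScaling.scaling_limits {ν : ℝ → Measure ℝ} {d : ℕ} {K : ℝ}
    (hq : QuadraticScaling ν d K) (hK : 0 < K) (hd : 0 < d) [∀ ε, IsProbabilityMeasure (ν ε)]
    (hb : ∀ ε, 0 < ε → Balanced (ν ε)) (hκ : 0 ≤ κ) (hl : 0 < l)
    (hσ : ∀ n : ℕ, 1 ≤ n → 0 < σ n ∧ σ n ^ 2 = l ^ 2 * (n : ℝ) ^ (-ρ)) {a : ℕ → ℝ}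
    (ha : ∀ n, 1 ≤ n →
      a n = ∫ x, min 1 (Real.exp x) ∂sumLaw fun i : Fin n => ν (σ n / scale κ i)) :
    (ρ = 2 * κ + 1 / d →
      Tendsto a atTop (𝓝 (2 * Phi (-(l ^ d / 2) * √(K / (1 + 2 * d * κ)))))) ∧
    (2 * κ + 1 / d < ρ → Tendsto a atTop (𝓝 1)) ∧
    (2 * κ < ρ → ρ < 2 * κ + 1 / d → ∀ p : ℝ, 0 ≤ p →
      Tendsto (fun n : ℕ => (n : ℝ) ^ p * a n) atTop (𝓝 0)) := by
  have hd' : (0 : ℝ) < d := by exact_mod_cast hd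
  have hs : 0 ≤ 2 * d * κ := by positivity
  have hT := tendsto_sum_rpow_div hs
  have hsum : ∀ᶠ n : ℕ in atTop, l ^ (2 * d) * ((n : ℝ) ^ (1 + 2 * d * κ - d * ρ)
        * ((∑ i : Fin n, ((i : ℝ) + 1) ^ (2 * d * κ)) / (n : ℝ) ^ (2 * d * κ + 1)))
      = ∑ i : Fin n, (σ n / scale κ i) ^ (2 * d) := by
    filter_upwards [eventually_ge_atTop 1] with n hn using (sum_step_pow hσ d hn).symm
  have hev : ∀ᶠ n in atTop,
      ∫ x, min 1 (Real.exp x) ∂sumLaw (fun i : Fin n => ν (σ n / scale κ i)) = a n := by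
    filter_upwards [eventually_ge_atTop 1] with n hn using (ha n hn).symm
  have hpos : ∀ᶠ n in atTop, ∀ i : Fin n, 0 < σ n / scale κ i := by
    filter_upwards [eventually_ge_atTop 1] with n hn i using
      div_pos (hσ n hn).1 (scale_pos κ i)
  have hsmall (h : 2 * κ < ρ) (δ : ℝ) (hδ : 0 < δ) :
      ∀ᶠ n in atTop, ∀ i : Fin n, σ n / scale κ i < δ := eventually_step_lt hκ hσ h hδ
  refine ⟨fun h => ?_, fun h => ?_, fun h1 h2 p hp => ?_⟩
  · have hlt : 2 * κ < ρ := by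
      have : (0 : ℝ) < 1 / d := by positivity
      linarith
    have h0 : 1 + 2 * d * κ - d * ρ = 0 := by
      rw [h]
      field_simp
      ring
    simp only [h0, Real.rpow_zero, one_mul] at hsum
    have hS := (hT.const_mul (l ^ (2 * d))).congr' hsum
    have := hq.tendsto_integral_min_one_exp hK.le hb hd.ne' hpos (hsmall hlt) (by positivity) hS
    refine (this.congr' hev).trans (le_of_eq ?_)
    congr 3
    rw [show K * (l ^ (2 * d) * (1 / (2 * d * κ + 1))) = (l ^ d) ^ 2 * (K / (1 + 2 * d * κ)) by
      rw [← pow_mul, mul_comm d 2, add_comm 1]; ring, Real.sqrt_mul (by positivity),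
      Real.sqrt_sq (by positivity)]
    ring
  · have hlt : 2 * κ < ρ := by
      have : (0 : ℝ) < 1 / d := by positivity
      linarith
    have h0 : 0 < -(1 + 2 * d * κ - d * ρ) := by
      have := mul_lt_mul_of_pos_left h hd'
      have e : (d : ℝ) * (2 * κ + 1 / d) = 2 * d * κ + 1 := by field_simp
      linarith
    have hz : Tendsto (fun n : ℕ => (n : ℝ) ^ (1 + 2 * d * κ - d * ρ)) atTop (𝓝 0) := by
      have := (tendsto_rpow_neg_atTop h0).comp tendsto_natCast_atTop_atTop
      simp only [neg_neg] at this
      exact this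
    have hS := ((hz.mul hT).const_mul (l ^ (2 * d))).congr' hsum
    rw [zero_mul, mul_zero] at hS
    have := hq.tendsto_integral_min_one_exp hK.le hb hd.ne' hpos (hsmall hlt) le_rfl hS
    refine (this.congr' hev).trans (le_of_eq ?_)
    -- With S = 0 the limit is 2Φ(0), evaluated through the Dirac mass at 0.
    have e := integral_min_one_exp_gaussianReal 0
    simp only [NNReal.coe_zero, Real.sqrt_zero, gaussianReal_zero_var, integral_dirac] at e
    rw [mul_zero, Real.sqrt_zero, ← e]
    simp
  · have h0 : 0 < 1 + 2 * d * κ - d * ρ := by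
      have := mul_lt_mul_of_pos_left h2 hd'
      have e : (d : ℝ) * (2 * κ + 1 / d) = 2 * d * κ + 1 := by field_simp
      linarith
    set q := 1 + 2 * d * κ - d * ρ with hq'
    -- Half of the limit in `tendsto_sum_rpow_div` serves as an eventual lower bound, so the mean
    -- acceptance is at most exp(-b n^q). This beats n^p = (n^q)^(p/q).
    set b := K / 16 * (l ^ (2 * d) * (1 / (2 * d * κ + 1) / 2)) with hb'
    have hbpos : 0 < b := by positivity
    have hlim : Tendsto (fun n : ℕ => ((n : ℝ) ^ q) ^ (p / q) * Real.exp (-b * (n : ℝ) ^ q)) atTop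
        (𝓝 0) :=
      (tendsto_rpow_mul_exp_neg_mul_atTop_nhds_zero (p / q) b hbpos).comp
        ((tendsto_rpow_atTop h0).comp tendsto_natCast_atTop_atTop)
    have hhalf : (1 / (2 * d * κ + 1) / 2 : ℝ) < 1 / (2 * d * κ + 1) := half_lt_self (by positivity)
    refine squeeze_zero' ?_ ?_ hlim
    · filter_upwards [hev] with n hn
      rw [← hn]
      exact mul_nonneg (by positivity) (integral_nonneg fun x => by positivity)
    · filter_upwards [hev, hsum, hT.eventually_const_lt hhalf,
        hq.eventually_integral_min_one_exp_le hK hb hpos (hsmall h1)] with n hn hsn hTn hle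
      have e : ((n : ℝ) ^ q) ^ (p / q) = (n : ℝ) ^ p := by
        rw [← Real.rpow_mul (Nat.cast_nonneg n), mul_div_cancel₀ _ h0.ne']
      rw [e, ← hn]
      refine mul_le_mul_of_nonneg_left (hle.trans (Real.exp_le_exp.2 ?_)) (by positivity)
      rw [← hsn, neg_mul, neg_mul, neg_le_neg_iff, hb']
      calc K / 16 * (l ^ (2 * d) * (1 / (2 * d * κ + 1) / 2)) * (n : ℝ) ^ q
          = K / 16 * (l ^ (2 * d) * ((n : ℝ) ^ q * (1 / (2 * d * κ + 1) / 2))) := by ring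
        _ ≤ _ := by gcongr

end Steps

lemma isProbabilityMeasure_ratioLaw {g m : ℝ → ℝ} (hg : RegularPotential g) (hm : Measurable m)
    (ε : ℝ) : IsProbabilityMeasure (ratioLaw g m ε) :=
  have := hg.isProbabilityMeasure_baseLaw
  Measure.isProbabilityMeasure_map
    (measurable_noiseLogRatio hg.smooth.continuous.measurable hm ε).aemeasurable

end MHScaling

theorem theorem1 (g : ℝ → ℝ) (hg : MHScaling.RegularPotential g)
    (κ l ρ : ℝ) (hκ : 0 ≤ κ) (hl : 0 < l) (hρ : 0 < ρ)
    (σ : ℕ → ℝ) (hσ : ∀ n : ℕ, 1 ≤ n → 0 < σ n ∧ σ n ^ 2 = l ^ 2 * (n : ℝ) ^ (-ρ)) :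
    (0 < MHScaling.constRWM g ∧ 0 < MHScaling.constSLA g) ∧
    -- random walk Metropolis, `I = 1`
    ((ρ = 2 * κ + 1 →
        Tendsto (fun n : ℕ => MHScaling.meanAcceptanceRWM g κ n (σ n)) atTop
          (𝓝 (2 * MHScaling.Phi (-(l / 2) * √(MHScaling.constRWM g / (1 + 2 * κ)))))) ∧
      (2 * κ + 1 < ρ →
        Tendsto (fun n : ℕ => MHScaling.meanAcceptanceRWM g κ n (σ n)) atTop (𝓝 1)) ∧
      (2 * κ < ρ → ρ < 2 * κ + 1 → ∀ p : ℝ, 0 ≤ p →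
        Tendsto (fun n : ℕ => (n : ℝ) ^ p * MHScaling.meanAcceptanceRWM g κ n (σ n))
          atTop (𝓝 0))) ∧
    -- simplified Langevin algorithm, `I = 1 / 3`
    ((ρ = 2 * κ + 1 / 3 →
        Tendsto (fun n : ℕ => MHScaling.meanAcceptanceSLA g κ n (σ n)) atTop
          (𝓝 (2 * MHScaling.Phi (-(l ^ 3 / 2) * √(MHScaling.constSLA g / (1 + 6 * κ)))))) ∧
      (2 * κ + 1 / 3 < ρ →
        Tendsto (fun n : ℕ => MHScaling.meanAcceptanceSLA g κ n (σ n)) atTop (𝓝 1)) ∧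
      (2 * κ < ρ → ρ < 2 * κ + 1 / 3 → ∀ p : ℝ, 0 ≤ p →
        Tendsto (fun n : ℕ => (n : ℝ) ^ p * MHScaling.meanAcceptanceSLA g κ n (σ n))
          atTop (𝓝 0)))
 := by
  have hgm : Measurable g := hg.smooth.continuous.measurable
  have hR (ε : ℝ) : IsProbabilityMeasure (MHScaling.ratioLaw g (fun u => u) ε) :=
    MHScaling.isProbabilityMeasure_ratioLaw hg measurable_id ε
  have hL (ε : ℝ) :=
    MHScaling.isProbabilityMeasure_ratioLaw hg (MHScaling.measurable_langevinMean (g := g) ε) ε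
  have rwm := hg.quadraticScaling_rwm.scaling_limits hg.constRWM_pos one_pos
    (fun ε hε => MHScaling.balanced_ratioLaw hgm measurable_id hε) hκ hl hσ
    fun n hn => MHScaling.meanAcceptanceRWM_eq hg (hσ n hn).1
  have sla := hg.quadraticScaling_langevin.scaling_limits hg.constSLA_pos (by norm_num)
    (fun ε hε => MHScaling.balanced_ratioLaw hgm (MHScaling.measurable_langevinMean ε) hε) hκ hl hσ
    fun n hn => MHScaling.meanAcceptanceSLA_eq hg (hσ n hn).1
  refine ⟨⟨hg.constRWM_pos, hg.constSLA_pos⟩, ?_, ?_⟩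
  · norm_num at rwm ⊢
    exact rwm
  · norm_num at sla ⊢
    exact sla
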